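/- **Setting.** Let $E$ be a complex Banach space and let $L$ be a complex solvable Lie algebra of finite dimension $n$ acting on $E$ on the right by bounded operators: each $x\in L$ gives a bounded operator $e\mapsto ex$, linearly in $x$, with $e[x,y]=(ex)y-(ey)x$ (for instance, $L$ is a Lie subalgebra of $\mathcal L(E)$, operators being written on the right). Put $L^{2}=[L,L]$ and $L^{2\perp}=\{f\in L^*: f(L^2)=0\}$. For $f\in L^{2\perp}$ and $1\le p\le n$ let $d_p(f):E\otimes\wedge^pL\to E\otimes\wedge^{p-1}L$ be given by $$d_p(f)\,e\langle y_1\wedge\dots\wedge y_p\rangle=\sum_{k=1}^p(-1)^{k+1}e(y_k-f(y_k))\langle y_1\wedge\dots\widehat{y_k}\dots\wedge y_p\rangle+\sum_{k<l}(-1)^{k+l}e\langle[y_k,y_l]\wedge y_1\wedge\dots\widehat{y_k}\dots\widehat{y_l}\dots\wedge y_p\rangle,$$ and let $d_p(f)=0$ for $p\le0$ and $p\ge n+1$. The spaces $E\otimes\wedge^pL$ carry the product topology of a finite power of $E$; $R$ denotes the range. Let $$\Sigma_p(L,E)=\{f\in L^{2\perp}: R(d_{p+1}(f))\ne\ker d_p(f)\},$$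 and for $0\le k\le n$ $$\sigma_{\delta,k}(L,E)=\bigcup_{0\le p\le k}\Sigma_p(L,E),\qquad \sigma_{\pi,k}(L,E)=\bigcup_{k\le p\le n}\Sigma_p(L,E)\ \cup\ \{f\in L^{2\perp}: R(d_k(f))\text{ is not closed}\}.$$ Let $L'$ be the vector space $L$ with the opposite bracket $[x,y]'=[y,x]$; it acts on the right on the dual Banach space $E^*$, the element $x$ acting as the adjoint of the operator $e\mapsto ex$. Let $x_1,\dots,x_n$ be a basis of $L$ such that $[x_j,x_i]$ is a linear combination of $x_1,\dots,x_i$ whenever $i<j$. Let $L_i$ be the ideal generated by $x_1,\dots,x_i$, let $\tilde\theta(x_i)$ be the restriction of $\operatorname{ad}(x_i)=[x_i,\cdot]$ to $L_i$, and put $$\tau=(\operatorname{trace}\tilde\theta(x_1),\dots,\operatorname{trace}\tilde\theta(x_n))\in\mathbb C^n.$$ **Theorem 4.9.** Identify linear forms on $L$ (and on $L'$) with vectors of $\mathbb C^n$ by their coordinates $(f(x_1),\dots,f(x_n))$ in the dual basis of $x_1,\dots,x_n$. Then for every $0\le k\le n$: (i) $\sigma_{\delta,k}(L,E)+\tau=\sigma_{\pi,n-k}(L',E^*)$;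 (ii) $\sigma_{\pi,k}(L,E)=\sigma_{\delta,n-k}(L',E^*)-\tau$. -/

import Mathlib

open scoped TensorProduct Topology

noncomputable section

namespace LieSpectra

/-- A right action of the Lie algebra `L` on the normed space `E` by bounded operators: the
operator `op x` is `e ↦ e · x`, and `e · [x, y] = (e · x) · y - (e · y) · x`. A Lie subalgebra
of the bounded operators on `E`, with operators written on the right, is the case in which `op`
is the inclusion. -/
structure RightAction (L E : Type*) [LieRing L] [LieAlgebra ℂ L] [NormedAddCommGroup E]
    [NormedSpace ℂ E] where
  op : L →ₗ[ℂ] E →L[ℂ] E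
  op_lie : ∀ (x y : L) (e : E), op ⁅x, y⁆ e = op y (op x e) - op x (op y e)

section Complex

variable {L E : Type*} [LieRing L] [LieAlgebra ℂ L] [NormedAddCommGroup E] [NormedSpace ℂ E]

/-- The map `x ↦ (e ↦ e · (x - f x))`. -/
def shifted (ρ : RightAction L E) (f : Module.Dual ℂ L) : L →ₗ[ℂ] E →ₗ[ℂ] E where
  toFun x := (ρ.op x : E →ₗ[ℂ] E) - f x • LinearMap.id
  map_add' x y := by
    ext e
    simp [add_smul]
    abel
  map_smul' c x := by
    ext e
    simp [mul_smul, smul_sub]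

/-- The first sum in the boundary operator, for fixed `e`:
`x₀ ∧ ⋯ ∧ xₚ ↦ ∑ₖ (-1)ᵏ e · (xₖ - f xₖ) ⊗ (x₀ ∧ ⋯ x̂ₖ ⋯ ∧ xₚ)`. -/
def actionPart (ρ : RightAction L E) (f : Module.Dual ℂ L) (p : ℕ) :
    E →ₗ[ℂ] ⋀[ℂ]^(p + 1) L →ₗ[ℂ] E ⊗[ℂ] ⋀[ℂ]^p L where
  toFun e := exteriorPower.alternatingMapLinearEquiv <| AlternatingMap.alternatizeUncurryFin
    { toFun := fun x =>
        (TensorProduct.mk ℂ E (⋀[ℂ]^p L) (shifted ρ f x e)).compAlternatingMap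
          (exteriorPower.ιMulti ℂ p)
      map_add' := fun x y => by
        ext v
        simp [-TensorProduct.mk_apply]
      map_smul' := fun c x => by
        ext v
        simp [TensorProduct.smul_tmul'] }
  map_add' e e' := by
    ext v
    simp [AlternatingMap.alternatizeUncurryFin_apply, Finset.sum_add_distrib]
  map_smul' c e := by
    ext v
    simp [AlternatingMap.alternatizeUncurryFin_apply, TensorProduct.smul_tmul',
      Finset.smul_sum, smul_comm c]

variable (L) in
/-- `y ↦ z ↦ (x₁, …, xₚ) ↦ [y, z] ∧ x₁ ∧ ⋯ ∧ xₚ`. -/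
def bracketWedge (p : ℕ) :
    L →ₗ[ℂ] L →ₗ[ℂ] L [⋀^Fin p]→ₗ[ℂ] ⋀[ℂ]^(p + 1) L :=
  (LieModule.toEnd ℂ L L : L →ₗ[ℂ] Module.End ℂ L).compr₂
    (AlternatingMap.curryLeft (exteriorPower.ιMulti ℂ (p + 1)))

variable (L) in
/-- The bracket part of the boundary operator,
`∑_{k<l} (-1)^(k+l) [xₖ, xₗ] ∧ x₀ ∧ ⋯ x̂ₖ ⋯ x̂ₗ ⋯`, which vanishes in degree one. It is
written as `-1/2` of the sum over all ordered pairs, which is visibly alternating; see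
`bracketPart_succ_apply` for the formula with `k < l`. -/
def bracketPart : (p : ℕ) → ⋀[ℂ]^(p + 1) L →ₗ[ℂ] ⋀[ℂ]^p L
  | 0 => 0
  | p + 1 => exteriorPower.alternatingMapLinearEquiv <| (-(1 / 2) : ℂ) •
      AlternatingMap.alternatizeUncurryFin
        (AlternatingMap.alternatizeUncurryFinLM ∘ₗ bracketWedge L p)

/-- The pairs `k < l` of indices are `k = i`, `l = j + 1` with `i ≤ j`. -/
theorem bracketPart_succ_apply (p : ℕ) (x : Fin (p + 2) → L) :
    bracketPart L (p + 1) (exteriorPower.ιMulti ℂ (p + 2) x) =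
      ∑ i : Fin (p + 1), ∑ j ≥ i, (-1 : ℤ) ^ (i + (j + 1) : ℕ) •
        exteriorPower.ιMulti ℂ (p + 1)
          (Matrix.vecCons ⁅x i.castSucc, x j.succ⁆
            (j.removeNth (i.castSucc.removeNth x))) := by
  have hb : ∀ (y z : L) (v : Fin p → L), bracketWedge L p y z v =
      exteriorPower.ιMulti ℂ (p + 1) (Matrix.vecCons ⁅y, z⁆ v) := fun y z v => rfl
  have hs : ∀ (y z : L) (v : Fin p → L), bracketWedge L p y z v - bracketWedge L p z y v =
      (2 : ℂ) • bracketWedge L p y z v := by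
    intro y z v
    have : bracketWedge L p z y v = - bracketWedge L p y z v := by
      simp only [bracketWedge, LinearMap.compr₂_apply]
      simp only [LieHom.coe_toLinearMap, LieModule.toEnd_apply_apply]
      rw [← lie_skew z y, map_neg]
      rfl
    rw [this, two_smul, sub_neg_eq_add]
  rw [bracketPart, exteriorPower.alternatingMapLinearEquiv_apply_ιMulti,
    AlternatingMap.smul_apply, AlternatingMap.alternatizeUncurryFin_alternatizeUncurryFinLM_comp_apply]
  simp only [hs, Finset.smul_sum]
  refine Finset.sum_congr rfl fun i _ => Finset.sum_congr rfl fun j _ => ?_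
  rw [smul_comm (-(1 / 2) : ℂ), smul_smul, hb, ← add_assoc, pow_succ]
  norm_num

/-- The boundary operator from `E ⊗ ⋀^(p+1) L` to `E ⊗ ⋀^p L`. -/
def boundary (ρ : RightAction L E) (f : Module.Dual ℂ L) (p : ℕ) :
    E ⊗[ℂ] ⋀[ℂ]^(p + 1) L →ₗ[ℂ] E ⊗[ℂ] ⋀[ℂ]^p L :=
  TensorProduct.lift (actionPart ρ f p) + LinearMap.lTensor E (bracketPart L p)

theorem boundary_zero_tmul (ρ : RightAction L E) (f : Module.Dual ℂ L) (e : E) (x : Fin 1 → L) :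
    boundary ρ f 0 (e ⊗ₜ exteriorPower.ιMulti ℂ 1 x) =
      (ρ.op (x 0) e - f (x 0) • e) ⊗ₜ exteriorPower.ιMulti ℂ 0 (Fin.removeNth 0 x) := by
  simp [boundary, actionPart, bracketPart, shifted, AlternatingMap.alternatizeUncurryFin_apply,
    TensorProduct.sub_tmul, TensorProduct.smul_tmul']

/-- The boundary operator on decomposable elements. -/
theorem boundary_succ_tmul (ρ : RightAction L E) (f : Module.Dual ℂ L) (p : ℕ) (e : E)
    (x : Fin (p + 2) → L) :
    boundary ρ f (p + 1) (e ⊗ₜ exteriorPower.ιMulti ℂ (p + 2) x) =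
      (∑ k : Fin (p + 2), (-1 : ℤ) ^ (k : ℕ) •
        ((ρ.op (x k) e - f (x k) • e) ⊗ₜ[ℂ] exteriorPower.ιMulti ℂ (p + 1) (k.removeNth x))) +
      ∑ i : Fin (p + 1), ∑ j ≥ i, (-1 : ℤ) ^ (i + (j + 1) : ℕ) •
        (e ⊗ₜ[ℂ] exteriorPower.ιMulti ℂ (p + 1)
          (Matrix.vecCons ⁅x i.castSucc, x j.succ⁆
            (j.removeNth (i.castSucc.removeNth x)))) := by
  simp only [boundary, LinearMap.add_apply, TensorProduct.lift.tmul, LinearMap.lTensor_tmul,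
    bracketPart_succ_apply]
  congr 1
  · simp [actionPart, shifted, AlternatingMap.alternatizeUncurryFin_apply,
      TensorProduct.sub_tmul, TensorProduct.smul_tmul']
  · simp only [TensorProduct.tmul_sum, TensorProduct.tmul_smul]

/-- The differential `d_p(f) : E ⊗ ⋀^p L → E ⊗ ⋀^(p-1) L`, with `d_0(f) = 0`. -/
def d (ρ : RightAction L E) (f : Module.Dual ℂ L) :
    (p : ℕ) → E ⊗[ℂ] ⋀[ℂ]^p L →ₗ[ℂ] E ⊗[ℂ] ⋀[ℂ]^(p - 1) L
  | 0 => 0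
  | p + 1 => boundary ρ f p

/-- The topology of `E ⊗ V` for a finite-dimensional vector space `V`: the coarsest one
for which every contraction `id ⊗ φ : E ⊗ V → E` with a linear form `φ` on `V` is continuous.
In a basis of `V` it is the product topology of a finite power of `E`. -/
@[reducible]
def tensorTopology (E V : Type*) [NormedAddCommGroup E] [NormedSpace ℂ E] [AddCommGroup V]
    [Module ℂ V] : TopologicalSpace (E ⊗[ℂ] V) :=
  ⨅ φ : Module.Dual ℂ V,
    TopologicalSpace.induced (fun t => TensorProduct.rid ℂ E (LinearMap.lTensor E φ t)) inferInstance

/-- The range of `d_p(f)` is closed. -/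
def HasClosedRange (ρ : RightAction L E) (f : Module.Dual ℂ L) (p : ℕ) : Prop :=
  IsClosed[tensorTopology E (⋀[ℂ]^(p - 1) L)]
    (LinearMap.range (d ρ f p) : Set (E ⊗[ℂ] ⋀[ℂ]^(p - 1) L))

variable (L) in
/-- The linear forms on `L` that vanish on `L² = [L, L]`, that is, the characters of `L`. -/
def characters : Set (Module.Dual ℂ L) := {f | ∀ x y : L, f ⁅x, y⁆ = 0}

/-- The characters for which the homology in degree `p` does not vanish. -/
def homologySet (ρ : RightAction L E) (p : ℕ) : Set (Module.Dual ℂ L) :=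
  {f | f ∈ characters L ∧ LinearMap.range (d ρ f (p + 1)) ≠ LinearMap.ker (d ρ f p)}

/-- The extended Słodkowski spectrum `σ_{δ,k}(L, E)`. -/
def sigmaDelta (ρ : RightAction L E) (k : ℕ) : Set (Module.Dual ℂ L) :=
  {f | ∃ p ≤ k, f ∈ homologySet ρ p}

/-- The extended Słodkowski spectrum `σ_{π,k}(L, E)`. -/
def sigmaPi (ρ : RightAction L E) (k : ℕ) : Set (Module.Dual ℂ L) :=
  {f | ∃ p, k ≤ p ∧ p ≤ Module.finrank ℂ L ∧ f ∈ homologySet ρ p} ∪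
    {f | f ∈ characters L ∧ ¬ HasClosedRange ρ f k}

end Complex

/-- The Lie algebra `L'`: the vector space `L` with the opposite bracket. -/
def Opposite (L : Type*) := L

section Opposite

variable (L : Type*) [LieRing L]

instance : AddCommGroup (Opposite L) := inferInstanceAs (AddCommGroup L)

instance : LieRing (Opposite L) where
  bracket x y := @Bracket.bracket L L _ y x
  add_lie x y z := @lie_add L L _ _ _ z x y
  lie_add x y z := @add_lie L L _ _ _ y z x
  lie_self x := @lie_self L _ x
  leibniz_lie x y z := by
    have h : ∀ x y z : L, ⁅⁅z, y⁆, x⁆ = ⁅z, ⁅y, x⁆⁆ + ⁅⁅z, x⁆, y⁆ := fun x y z => by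
      rw [lie_lie, ← lie_skew ⁅z, x⁆ y, sub_eq_add_neg]
    exact h x y z

variable [LieAlgebra ℂ L]

instance : Module ℂ (Opposite L) := inferInstanceAs (Module ℂ L)

instance : LieAlgebra ℂ (Opposite L) where
  lie_smul c x y := by
    have h : ∀ x y : L, ⁅c • y, x⁆ = c • ⁅y, x⁆ := fun x y => smul_lie c y x
    exact h x y

/-- The identity of the vector space `L`, as a map to `L'`. -/
def toOpposite : L ≃ₗ[ℂ] Opposite L := LinearEquiv.refl ℂ L

end Opposite

section Dual

variable {L E : Type*} [LieRing L] [LieAlgebra ℂ L] [NormedAddCommGroup E] [NormedSpace ℂ E]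

theorem lie_toOpposite (x y : L) : ⁅toOpposite L x, toOpposite L y⁆ = toOpposite L ⁅y, x⁆ := rfl

/-- The right action of `L'` on the dual Banach space `E*`: the element `x` acts by the adjoint
`ψ ↦ ψ ∘ x` of the operator by which it acts on `E`. -/
def RightAction.adjoint (ρ : RightAction L E) : RightAction (Opposite L) (StrongDual ℂ E) where
  op := (ContinuousLinearMap.compL ℂ E E ℂ).flip.toLinearMap ∘ₗ ρ.op ∘ₗ
    (toOpposite L).symm.toLinearMap
  op_lie x y ψ := by
    ext e
    have h : (toOpposite L).symm ⁅x, y⁆ =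
      ⁅(toOpposite L).symm y, (toOpposite L).symm x⁆ := rfl
    simp [h, ρ.op_lie]

theorem RightAction.adjoint_op_apply (ρ : RightAction L E) (x : L) (ψ : StrongDual ℂ E) (e : E) :
    ρ.adjoint.op (toOpposite L x) ψ e = ψ (ρ.op x e) := rfl

variable {n : ℕ}

/-- A triangular basis `x₁, …, xₙ` of `L`: if `i < j` then `[xⱼ, xᵢ]` is a
linear combination of `x₁, …, xᵢ`. -/
def IsTriangular (b : Module.Basis (Fin n) ℂ L) : Prop :=
  ∀ i j : Fin n, i < j → ⁅b j, b i⁆ ∈ Submodule.span ℂ (b '' Set.Iic i)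

/-- The ideal `Lᵢ` of `L` generated by `x₁, …, xᵢ`. -/
def flagIdeal (b : Module.Basis (Fin n) ℂ L) (i : Fin n) : LieIdeal ℂ L :=
  LieSubmodule.lieSpan ℂ L (b '' Set.Iic i)

/-- The trace of the restriction of `ad xᵢ` to the ideal `Lᵢ`. -/
def flagTrace (b : Module.Basis (Fin n) ℂ L) (i : Fin n) : ℂ :=
  LinearMap.trace ℂ (flagIdeal b i) (LieModule.toEnd ℂ L (flagIdeal b i) (b i))

/-- The coordinates `(f(x₁), …, f(xₙ))` of a linear form in the dual basis. -/
def dualCoords {V : Type*} [AddCommGroup V] [Module ℂ V] (b : Module.Basis (Fin n) ℂ V)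
    (f : Module.Dual ℂ V) : Fin n → ℂ :=
  fun i => f (b i)

end Dual

end LieSpectra

end

/-! The proof rests on Poincaré duality for the exterior algebra. Pair `⋀^p L` with `⋀^(n-p) L'` by
taking the coefficient of `b₁ ∧ ⋯ ∧ bₙ` in the reversal of `ω` times `η`. This pairing is perfect,
so `E* ⊗ ⋀^(n-p) L'` is the Banach dual of `E ⊗ ⋀^p L`.

The key identity (`tensorPairing_boundary`) says that the adjoint of `d_(p+1)(f)` is the
differential `d_(n-p)` of `L'` on `E*`, taken at the character `f + trace ∘ ad`. Thanks to the
reversal, left multiplications and contractions cross the pairing without signs. The bracket part is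
`-1/2` times a sum of terms "contract twice, then multiply by `[bᵢ, bⱼ]`"; crossing reverses the
order of these operations, and restoring it leaves the term `∑ trace (ad bᵢ) · contractᵢ`
(`wedgePairing_bracketOp`). That term has the same shape as a shift of the character, which is where
`τ` comes from: `Lᵢ` is an ideal containing `xᵢ`, so `ad xᵢ` has the same trace on `Lᵢ` as on `L`.

The rest is the closed range theorem. A range is closed iff the adjoint range is. Exactness passes
to the adjoint sequence when the outgoing map has closed range, and comes back when the incoming map
has closed range. Exactness in one degree makes the incoming range a kernel, hence closed, so over
an interval of degrees closedness is automatic except at one edge; the closed range clause in `σ_π`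
supplies exactly that edge (`mem_sigmaDelta_iff`, `mem_sigmaPi_iff`). -/

noncomputable section

namespace LieSpectra

/-! ### The closed range theorem. -/

section ClosedRange

variable {X Y : Type*} [NormedAddCommGroup X] [NormedSpace ℂ X]
  [NormedAddCommGroup Y] [NormedSpace ℂ Y]

/-- The adjoint of a bounded operator between Banach spaces. -/
def dualMap (A : X →L[ℂ] Y) : StrongDual ℂ Y →L[ℂ] StrongDual ℂ X :=
  (ContinuousLinearMap.compL ℂ X Y ℂ).flip A

@[simp]
theorem dualMap_apply (A : X →L[ℂ] Y) (ψ : StrongDual ℂ Y) (x : X) :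
    dualMap A ψ x = ψ (A x) := rfl

/-- A bounded operator with closed range admits preimages of controlled norm. -/
theorem exists_norm_le_of_isClosed_range [CompleteSpace X] [CompleteSpace Y]
    (A : X →L[ℂ] Y) (hA : IsClosed (Set.range A)) :
    ∃ C > 0, ∀ x, ∃ x', A x' = A x ∧ ‖x'‖ ≤ C * ‖A x‖ := by
  have hc : IsClosed (LinearMap.range (A : X →ₗ[ℂ] Y) : Set Y) := hA
  have : CompleteSpace (LinearMap.range (A : X →ₗ[ℂ] Y)) := hc.completeSpace_coe
  let A' : X →L[ℂ] LinearMap.range (A : X →ₗ[ℂ] Y) :=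
    A.codRestrict _ fun x => LinearMap.mem_range_self (A : X →ₗ[ℂ] Y) x
  have hs : Function.Surjective A' := by
    rintro ⟨_, x, rfl⟩
    exact ⟨x, rfl⟩
  obtain ⟨C, hC, h⟩ := A'.exists_preimage_norm_le hs
  refine ⟨C, hC, fun x => ?_⟩
  obtain ⟨x', hx', hn⟩ := h (A' x)
  exact ⟨x', congrArg Subtype.val hx', hn⟩

/-- If `A` has closed range, every bounded form vanishing on its kernel factors through `A`. -/
theorem exists_dual_comp_eq [CompleteSpace X] [CompleteSpace Y]
    (A : X →L[ℂ] Y) (hA : IsClosed (Set.range A))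
    (φ : StrongDual ℂ X) (hφ : ∀ x, A x = 0 → φ x = 0) : ∃ ψ : StrongDual ℂ Y, dualMap A ψ = φ := by
  obtain ⟨C, hC, h⟩ := exists_norm_le_of_isClosed_range A hA
  have hφ' : ∀ x x', A x = A x' → φ x = φ x' := fun x x' e => by
    have := hφ (x - x') (by rw [map_sub, e, sub_self])
    rwa [map_sub, sub_eq_zero] at this
  -- The section `s` is only algebraic. Still `φ ∘ s` is bounded, since `φ` takes the same value on
  -- the preimage of controlled norm.
  obtain ⟨s, hs⟩ := ((A : X →ₗ[ℂ] Y).rangeRestrict).exists_rightInverse_of_surjective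
    (LinearMap.range_rangeRestrict _)
  have hs' : ∀ y, A (s y) = y := fun y => congrArg Subtype.val (LinearMap.congr_fun hs y)
  let g : StrongDual ℂ (LinearMap.range (A : X →ₗ[ℂ] Y)) :=
    ((φ : X →ₗ[ℂ] ℂ) ∘ₗ s).mkContinuous (‖φ‖ * C) fun y => by
      obtain ⟨x', hx', hn⟩ := h (s y)
      rw [hs' y] at hx' hn
      change ‖φ (s y)‖ ≤ _
      rw [hφ' (s y) x' (by rw [hs', hx']), mul_assoc]
      exact (φ.le_opNorm x').trans (by gcongr; exact hn)
  obtain ⟨ψ, hψ, -⟩ := exists_extension_norm_eq _ g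
  refine ⟨ψ, ?_⟩
  ext x
  have := hψ ⟨A x, LinearMap.mem_range_self (A : X →ₗ[ℂ] Y) x⟩
  rw [dualMap_apply]
  refine this.trans (hφ' _ _ (hs' _))

/-- The adjoint of an operator with closed range has closed range. -/
theorem isClosed_range_dualMap [CompleteSpace X] [CompleteSpace Y]
    (A : X →L[ℂ] Y) (hA : IsClosed (Set.range A)) :
    IsClosed (Set.range (dualMap A)) := by
  -- The range is the annihilator of `ker A`, an intersection of closed hyperplanes.
  have : Set.range (dualMap A) = ⋂ (x : X) (_ : A x = 0), {φ | φ x = 0} := by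
    ext φ
    simp only [Set.mem_iInter, Set.mem_ofPred_eq]
    refine ⟨?_, fun h => exists_dual_comp_eq A hA φ h⟩
    rintro ⟨ψ, rfl⟩ x hx
    rw [dualMap_apply, hx, map_zero]
  rw [this]
  exact isClosed_iInter fun x => isClosed_iInter fun _ =>
    isClosed_eq (by fun_prop) continuous_const

/-- An operator that is approximately onto, with control of norms, is onto. -/
theorem surjective_of_approx [CompleteSpace X]
    (A : X →L[ℂ] Y) (C : ℝ)
    (h : ∀ y, ∃ x, ‖y - A x‖ ≤ 1 / 2 * ‖y‖ ∧ ‖x‖ ≤ C * ‖y‖) : Function.Surjective A := by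
  choose g hg hgn using h
  intro y
  -- The residual after one correction; iterating halves it, and the corrections sum to a preimage.
  let r : Y → Y := fun z => z - A (g z)
  have hr : ∀ k, ‖r^[k] y‖ ≤ (1 / 2) ^ k * ‖y‖ := by
    intro k
    induction k with
    | zero => simp
    | succ k ih =>
      rw [Function.iterate_succ_apply', pow_succ']
      calc _ ≤ 1 / 2 * ‖r^[k] y‖ := hg _
        _ ≤ 1 / 2 * ((1 / 2) ^ k * ‖y‖) := by gcongr
        _ = _ := by ring
  have hC : ∀ k, ‖g (r^[k] y)‖ ≤ |C| * ‖y‖ * (1 / 2) ^ k := fun k =>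
    calc _ ≤ C * ‖r^[k] y‖ := hgn _
      _ ≤ |C| * ((1 / 2) ^ k * ‖y‖) := by
        gcongr
        · exact le_abs_self C
        · exact hr k
      _ = _ := by ring
  have hsum : Summable fun k => g (r^[k] y) :=
    Summable.of_norm_bounded (summable_geometric_two.mul_left _) hC
  refine ⟨∑' k, g (r^[k] y), ?_⟩
  have hpart : ∀ m, ∑ k ∈ Finset.range m, A (g (r^[k] y)) = y - r^[m] y := by
    intro m
    induction m with
    | zero => simp
    | succ m ih =>
      rw [Finset.sum_range_succ, ih, Function.iterate_succ_apply']
      simp only [r]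
      abel
  have h0 : Filter.Tendsto (fun m => r^[m] y) Filter.atTop (𝓝 0) := by
    refine squeeze_zero_norm hr ?_
    have := (tendsto_pow_atTop_nhds_zero_of_lt_one (r := (1 / 2 : ℝ)) (by norm_num)
      (by norm_num)).mul_const ‖y‖
    simpa using this
  have h1 := (A.hasSum hsum.hasSum).tendsto_sum_nat
  simp only [hpart] at h1
  have h2 := (tendsto_const_nhds (x := y)).sub h0
  rw [sub_zero] at h2
  exact tendsto_nhds_unique h1 h2

/-- A bounded form whose real part is at most `u` on the ball of radius `r` has norm at most
`u / r`. -/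
theorem norm_le_of_re_le (φ : StrongDual ℂ X) {u r : ℝ} (hr : 0 < r)
    (h : ∀ x, ‖x‖ ≤ r → (φ x).re ≤ u) : ‖φ‖ ≤ u / r := by
  have hu : 0 ≤ u := by simpa using h 0 (by simpa using hr.le)
  have key : ∀ x, ‖x‖ ≤ r → ‖φ x‖ ≤ u := by
    intro x hx
    rcases eq_or_ne (φ x) 0 with h0 | h0
    · rwa [h0, norm_zero]
    have hn : (‖φ x‖ : ℂ) ≠ 0 := by simpa using h0
    -- Rotating `x` by a phase keeps its norm and makes `φ` take the real value `‖φ x‖`.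
    have h1 := h (((starRingEnd ℂ) (φ x) / ‖φ x‖) • x) (by
      rw [norm_smul, norm_div, RCLike.norm_conj]
      simpa [h0] using hx)
    rw [map_smul, smul_eq_mul, div_mul_eq_mul_div, mul_comm, Complex.mul_conj,
      Complex.normSq_eq_norm_sq] at h1
    have h2 : (((‖φ x‖ ^ 2 : ℝ) : ℂ) / (‖φ x‖ : ℂ)) = ((‖φ x‖ : ℝ) : ℂ) := by
      field_simp
      push_cast
      ring
    rwa [h2, Complex.ofReal_re] at h1
  exact φ.opNorm_bound_of_ball_bound hr u fun x hx => key x (by simpa using hx)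

/-- The hard half of the closed range theorem. -/
theorem isClosed_range_of_dualMap [CompleteSpace X]
    (A : X →L[ℂ] Y) (hA : IsClosed (Set.range (dualMap A))) :
    IsClosed (Set.range A) := by
  obtain ⟨C, hC, hC'⟩ := exists_norm_le_of_isClosed_range (dualMap A) hA
  let Z : Submodule ℂ Y := (LinearMap.range (A : X →ₗ[ℂ] Y)).topologicalClosure
  have hAZ : ∀ x, A x ∈ Z := fun x =>
    Submodule.le_topologicalClosure _ (LinearMap.mem_range_self (A : X →ₗ[ℂ] Y) x)
  have happrox : ∀ y ∈ Z, ∃ x, ‖y - A x‖ ≤ 1 / 2 * ‖y‖ ∧ ‖x‖ ≤ C * ‖y‖ := by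
    intro y hy
    rcases eq_or_ne y 0 with rfl | hy0
    · exact ⟨0, by simp⟩
    have hypos : 0 < ‖y‖ := norm_pos_iff.mpr hy0
    have hr : 0 < C * ‖y‖ := by positivity
    -- Otherwise Hahn–Banach separates `y` from this closed convex set.
    suffices hmem : y ∈ closure (A '' Metric.closedBall 0 (C * ‖y‖)) by
      obtain ⟨_, ⟨x, hx, rfl⟩, hd⟩ := Metric.mem_closure_iff.mp hmem (1 / 2 * ‖y‖) (by positivity)
      rw [dist_eq_norm] at hd
      exact ⟨x, hd.le, by simpa using hx⟩
    by_contra hmem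
    have hconv : Convex ℝ (closure (A '' Metric.closedBall 0 (C * ‖y‖))) := by
      refine Convex.closure ?_
      exact (convex_closedBall (0 : X) _).linear_image ((A : X →ₗ[ℂ] Y).restrictScalars ℝ)
    obtain ⟨ψ, u, hu, huy⟩ :=
      RCLike.geometric_hahn_banach_closed_point (𝕜 := ℂ) hconv isClosed_closure hmem
    have hnorm : ‖dualMap A ψ‖ ≤ u / (C * ‖y‖) := norm_le_of_re_le _ hr fun x hx =>
      (hu _ (subset_closure ⟨x, by simpa using hx, rfl⟩)).le
    -- The form `ψ'` agrees with `ψ` on the closure `Z` of the range but has norm at most `C *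
    -- ‖dualMap A ψ‖`. This yields `‖ψ y‖ ≤ u`, against the separation.
    obtain ⟨ψ', hψ', hn⟩ := hC' ψ
    have heq : ψ' y = ψ y := by
      have hcl : IsClosed {z | ψ' z = ψ z} := isClosed_eq (by fun_prop) (by fun_prop)
      refine closure_minimal ?_ hcl hy
      rintro _ ⟨x, rfl⟩
      exact DFunLike.congr_fun hψ' x
    have h1 : ‖ψ y‖ ≤ u := by
      rw [← heq]
      calc ‖ψ' y‖ ≤ ‖ψ'‖ * ‖y‖ := ψ'.le_opNorm y
        _ ≤ C * (u / (C * ‖y‖)) * ‖y‖ := by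
          gcongr
          exact hn.trans (by gcongr)
        _ = u := by field_simp
    have h2 : RCLike.re (ψ y) ≤ ‖ψ y‖ := RCLike.re_le_norm _
    linarith
  have hs := surjective_of_approx (A.codRestrict Z hAZ) C fun y => happrox y y.2
  have : Set.range A = (Z : Set Y) := by
    ext y
    refine ⟨?_, fun hy => ?_⟩
    · rintro ⟨x, rfl⟩
      exact hAZ x
    · obtain ⟨x, hx⟩ := hs ⟨y, hy⟩
      exact ⟨x, congrArg Subtype.val hx⟩
  rw [this]
  exact Submodule.isClosed_topologicalClosure _

/-- A linear map between Banach spaces that has an adjoint is bounded. -/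
theorem continuous_of_adjoint [CompleteSpace X] [CompleteSpace Y]
    (A : X →ₗ[ℂ] Y) (A' : StrongDual ℂ Y → StrongDual ℂ X)
    (h : ∀ ψ x, A' ψ x = ψ (A x)) : Continuous A := by
  -- Closed graph theorem: the two candidate limits agree under every bounded form, because of the
  -- adjoint.
  refine A.continuous_of_seq_closed_graph fun u x y hu hy => ?_
  refine (SeparatingDual.eq_iff_forall_dual_eq (R := ℂ)).mpr fun ψ => ?_
  have h1 := (ψ.continuous.tendsto y).comp hy
  have h2 := ((A' ψ).continuous.tendsto x).comp hu
  rw [h] at h2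
  refine tendsto_nhds_unique h1 (h2.congr fun k => ?_)
  simp [h]

/-- A point outside a closed subspace is separated from it by a bounded form. -/
theorem exists_dual_eq_zero_of_notMem {p : Submodule ℂ X} (hp : IsClosed (p : Set X)) {x : X}
    (hx : x ∉ p) : ∃ ψ : StrongDual ℂ X, (∀ y ∈ p, ψ y = 0) ∧ ψ x ≠ 0 := by
  -- Closedness makes the quotient a normed space, where a nonzero class is detected by a bounded
  -- form.
  have : IsClosed (p : Set X) := hp
  obtain ⟨g, hg⟩ := SeparatingDual.exists_ne_zero (R := ℂ) (x := p.mkQ x)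
    (by rwa [Ne, Submodule.mkQ_apply, Submodule.Quotient.mk_eq_zero])
  refine ⟨g.comp p.mkQL, fun y hy => ?_, hg⟩
  have : p.mkQ y = 0 := by rwa [Submodule.mkQ_apply, Submodule.Quotient.mk_eq_zero]
  change g (p.mkQ y) = 0
  rw [this, map_zero]

end ClosedRange

/-! ### Closed ranges and exactness under abstract Banach duality. -/

/-- A pairing between `M` and `N` that is modelled on the pairing of the Banach space `X` with
its dual, together with topologies on `M` and `N`. -/
structure BanachDuality (M N X : Type*) [AddCommGroup M] [Module ℂ M] [AddCommGroup N]
    [Module ℂ N] [NormedAddCommGroup X] [NormedSpace ℂ X] (τM : TopologicalSpace M)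
    (τN : TopologicalSpace N) where
  toBanach : M ≃ₗ[ℂ] X
  toDual : N ≃ₗ[ℂ] StrongDual ℂ X
  isClosed_left : ∀ S : Set M, IsClosed[τM] S ↔ IsClosed (toBanach '' S)
  isClosed_right : ∀ S : Set N, IsClosed[τN] S ↔ IsClosed (toDual '' S)

namespace BanachDuality

variable {M₁ N₁ X₁ M₂ N₂ X₂ M₃ N₃ X₃ : Type*}
  [AddCommGroup M₁] [Module ℂ M₁] [AddCommGroup N₁] [Module ℂ N₁]
  [NormedAddCommGroup X₁] [NormedSpace ℂ X₁]
  [AddCommGroup M₂] [Module ℂ M₂] [AddCommGroup N₂] [Module ℂ N₂]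
  [NormedAddCommGroup X₂] [NormedSpace ℂ X₂]
  [AddCommGroup M₃] [Module ℂ M₃] [AddCommGroup N₃] [Module ℂ N₃]
  [NormedAddCommGroup X₃] [NormedSpace ℂ X₃]
  {τM₁ : TopologicalSpace M₁} {τN₁ : TopologicalSpace N₁}
  {τM₂ : TopologicalSpace M₂} {τN₂ : TopologicalSpace N₂}
  {τM₃ : TopologicalSpace M₃} {τN₃ : TopologicalSpace N₃}
  (P₁ : BanachDuality M₁ N₁ X₁ τM₁ τN₁) (P₂ : BanachDuality M₂ N₂ X₂ τM₂ τN₂)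
  (P₃ : BanachDuality M₃ N₃ X₃ τM₃ τN₃)

/-- `D` and `D'` are adjoint to each other. -/
def IsAdjoint (D : M₁ →ₗ[ℂ] M₂) (D' : N₂ →ₗ[ℂ] N₁) : Prop :=
  ∀ m s, P₁.toDual (D' s) (P₁.toBanach m) = P₂.toDual s (P₂.toBanach (D m))

variable {P₁ P₂ P₃} {D : M₁ →ₗ[ℂ] M₂} {D' : N₂ →ₗ[ℂ] N₁} {C : M₂ →ₗ[ℂ] M₃} {C' : N₃ →ₗ[ℂ] N₂}

theorem isAdjoint_zero : IsAdjoint P₁ P₂ 0 0 := fun m s => by simp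

/-- The bounded operator that models a map with an adjoint. -/
theorem IsAdjoint.exists_operator [CompleteSpace X₁] [CompleteSpace X₂]
    (h : IsAdjoint P₁ P₂ D D') :
    ∃ A : X₁ →L[ℂ] X₂, (∀ m, A (P₁.toBanach m) = P₂.toBanach (D m)) ∧
      ∀ s, dualMap A (P₂.toDual s) = P₁.toDual (D' s) := by
  let A : X₁ →ₗ[ℂ] X₂ := P₂.toBanach.toLinearMap ∘ₗ D ∘ₗ P₁.toBanach.symm.toLinearMap
  have hA : Continuous A := continuous_of_adjoint A
    (fun ψ => P₁.toDual (D' (P₂.toDual.symm ψ))) fun ψ x => by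
      have := h (P₁.toBanach.symm x) (P₂.toDual.symm ψ)
      simpa [A] using this
  refine ⟨⟨A, hA⟩, fun m => by simp [A], fun s => ?_⟩
  ext x
  have := h (P₁.toBanach.symm x) s
  simpa [A] using this.symm

theorem image_range_left {A : X₁ →L[ℂ] X₂} (hA : ∀ m, A (P₁.toBanach m) = P₂.toBanach (D m)) :
    P₂.toBanach '' (LinearMap.range D : Set M₂) = Set.range A := by
  ext y
  constructor
  · rintro ⟨_, ⟨m, rfl⟩, rfl⟩
    exact ⟨_, hA m⟩
  · rintro ⟨x, rfl⟩
    exact ⟨D (P₁.toBanach.symm x), ⟨_, rfl⟩, by rw [← hA, LinearEquiv.apply_symm_apply]⟩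

theorem image_range_right {A : X₁ →L[ℂ] X₂}
    (hA : ∀ s, dualMap A (P₂.toDual s) = P₁.toDual (D' s)) :
    P₁.toDual '' (LinearMap.range D' : Set N₁) = Set.range (dualMap A) := by
  ext y
  constructor
  · rintro ⟨_, ⟨m, rfl⟩, rfl⟩
    exact ⟨_, hA m⟩
  · rintro ⟨x, rfl⟩
    exact ⟨D' (P₂.toDual.symm x), ⟨_, rfl⟩, by rw [← hA, LinearEquiv.apply_symm_apply]⟩

/-- The closed range theorem for adjoint maps. -/
theorem IsAdjoint.isClosed_range_iff [CompleteSpace X₁] [CompleteSpace X₂]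
    (h : IsAdjoint P₁ P₂ D D') :
    IsClosed[τM₂] (LinearMap.range D : Set M₂) ↔ IsClosed[τN₁] (LinearMap.range D' : Set N₁) := by
  obtain ⟨A, hA, hA'⟩ := h.exists_operator
  rw [P₂.isClosed_left, P₁.isClosed_right, image_range_left hA, image_range_right hA']
  exact ⟨isClosed_range_dualMap A, isClosed_range_of_dualMap A⟩

theorem IsAdjoint.isClosed_ker [CompleteSpace X₁] [CompleteSpace X₂]
    (h : IsAdjoint P₁ P₂ D D') : IsClosed[τM₁] (LinearMap.ker D : Set M₁) := by
  obtain ⟨A, hA, -⟩ := h.exists_operator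
  have : P₁.toBanach '' (LinearMap.ker D : Set M₁) = A ⁻¹' {0} := by
    ext x
    obtain ⟨m, rfl⟩ := P₁.toBanach.surjective x
    simp [hA]
  rw [P₁.isClosed_left, this]
  exact isClosed_singleton.preimage A.continuous

/-- Exactness passes to the adjoint sequence if the second map has closed range. -/
theorem IsAdjoint.range_eq_ker_right [CompleteSpace X₂] [CompleteSpace X₃]
    (hD : IsAdjoint P₁ P₂ D D') (hC : IsAdjoint P₂ P₃ C C')
    (hcl : IsClosed[τM₃] (LinearMap.range C : Set M₃)) (hex : LinearMap.range D = LinearMap.ker C) :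
    LinearMap.range C' = LinearMap.ker D' := by
  obtain ⟨A, hA, hA'⟩ := hC.exists_operator
  rw [P₃.isClosed_left, image_range_left hA] at hcl
  apply le_antisymm
  · rintro _ ⟨s, rfl⟩
    rw [LinearMap.mem_ker]
    apply P₁.toDual.injective
    ext x
    obtain ⟨m, rfl⟩ := P₁.toBanach.surjective x
    have : C (D m) = 0 := by
      rw [← LinearMap.mem_ker, ← hex]
      exact ⟨m, rfl⟩
    rw [hD, hC, this]
    simp
  · intro s hs
    rw [LinearMap.mem_ker] at hs
    -- An element of `ker D'` is a form that kills `range D = ker C`, so it factors through `C`.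
    obtain ⟨ψ, hψ⟩ := exists_dual_comp_eq A hcl (P₂.toDual s) fun x hx => by
      obtain ⟨m, rfl⟩ := P₂.toBanach.surjective x
      rw [hA, LinearEquiv.map_eq_zero_iff, ← LinearMap.mem_ker, ← hex] at hx
      obtain ⟨m', rfl⟩ := hx
      rw [← hD, hs]
      simp
    refine ⟨P₃.toDual.symm ψ, P₂.toDual.injective ?_⟩
    rw [← hA', LinearEquiv.apply_symm_apply, hψ]

/-- Exactness of the adjoint sequence implies exactness if the first map has closed range. -/
theorem IsAdjoint.range_eq_ker_left (hD : IsAdjoint P₁ P₂ D D') (hC : IsAdjoint P₂ P₃ C C')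
    (hcl : IsClosed[τM₂] (LinearMap.range D : Set M₂))
    (hex : LinearMap.range C' = LinearMap.ker D') :
    LinearMap.range D = LinearMap.ker C := by
  rw [P₂.isClosed_left] at hcl
  apply le_antisymm
  · rintro _ ⟨m, rfl⟩
    rw [LinearMap.mem_ker]
    apply P₃.toBanach.injective
    rw [map_zero]
    refine (SeparatingDual.eq_zero_iff_forall_dual_eq_zero (R := ℂ) _).mpr fun ψ => ?_
    obtain ⟨s, rfl⟩ := P₃.toDual.surjective ψ
    have : D' (C' s) = 0 := by
      rw [← LinearMap.mem_ker, ← hex]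
      exact ⟨s, rfl⟩
    rw [← hC, ← hD, this]
    simp
  · intro m hm
    rw [LinearMap.mem_ker] at hm
    by_contra hmem
    have hmem' : P₂.toBanach m ∉
        ((LinearMap.range D).map (P₂.toBanach : M₂ →ₗ[ℂ] X₂) : Submodule ℂ X₂) := by
      rintro ⟨m', hm', he⟩
      exact hmem (P₂.toBanach.injective he ▸ hm')
    -- A form killing `range D` lies in `ker D' = range C'`, hence vanishes on `ker C`, which
    -- contains `m`.
    obtain ⟨ψ, hψ, hψ'⟩ := exists_dual_eq_zero_of_notMem hcl hmem'
    obtain ⟨s, rfl⟩ := P₂.toDual.surjective ψ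
    have hs : s ∈ LinearMap.ker D' := by
      rw [LinearMap.mem_ker]
      apply P₁.toDual.injective
      ext x
      obtain ⟨m', rfl⟩ := P₁.toBanach.surjective x
      rw [hD, hψ (P₂.toBanach (D m')) ⟨D m', ⟨m', rfl⟩, rfl⟩]
      simp
    rw [← hex] at hs
    obtain ⟨t, rfl⟩ := hs
    apply hψ'
    rw [hC, hm]
    simp

end BanachDuality

/-! ### Topology and duality of `E ⊗ V` in coordinates. -/

section TensorDuality

variable {E V W ι : Type*} [NormedAddCommGroup E] [NormedSpace ℂ E] [AddCommGroup V] [Module ℂ V]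
  [AddCommGroup W] [Module ℂ W] [Fintype ι]

/-- The coordinates of `E ⊗ V` in a basis of `V`. -/
def tensorCoords (E : Type*) [NormedAddCommGroup E] [NormedSpace ℂ E] (v : Module.Basis ι ℂ V) :
    E ⊗[ℂ] V ≃ₗ[ℂ] (ι → E) :=
  letI := Classical.decEq ι
  TensorProduct.equivFinsuppOfBasisRight v ≪≫ₗ Finsupp.linearEquivFunOnFinite ℂ E ι

@[simp]
theorem tensorCoords_tmul (v : Module.Basis ι ℂ V) (e : E) (x : V) (i : ι) :
    tensorCoords E v (e ⊗ₜ x) i = v.repr x i • e := by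
  simp [tensorCoords]

theorem rid_lTensor_eq_sum (v : Module.Basis ι ℂ V) (φ : Module.Dual ℂ V) (t : E ⊗[ℂ] V) :
    TensorProduct.rid ℂ E (LinearMap.lTensor E φ t) = ∑ i, φ (v i) • tensorCoords E v t i := by
  induction t with
  | zero => simp
  | add s t hs ht => simp only [map_add, hs, ht, Pi.add_apply, smul_add, Finset.sum_add_distrib]
  | tmul e x =>
    simp only [LinearMap.lTensor_tmul, TensorProduct.rid_tmul, tensorCoords_tmul, smul_smul]
    rw [← Finset.sum_smul]
    congr 1
    conv_lhs => rw [← v.sum_repr x]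
    simp only [map_sum, map_smul, smul_eq_mul, mul_comm]

/-- The coordinates are themselves contractions, and every contraction is a finite linear
combination of coordinates. -/
theorem tensorTopology_eq_induced (v : Module.Basis ι ℂ V) :
    tensorTopology E V = TopologicalSpace.induced (tensorCoords E v) inferInstance := by
  apply le_antisymm
  · rw [← continuous_iff_le_induced]
    refine @continuous_pi _ _ _ (tensorTopology E V) _ _ fun i => ?_
    rw [continuous_iff_le_induced]
    refine (iInf_le _ (v.coord i)).trans (le_of_eq ?_)
    congr 1
    ext t
    rw [rid_lTensor_eq_sum v]
    simp
  · refine le_iInf fun φ => ?_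
    rw [← continuous_iff_le_induced]
    simp only [rid_lTensor_eq_sum v]
    let _ : TopologicalSpace (E ⊗[ℂ] V) := TopologicalSpace.induced (tensorCoords E v) inferInstance
    have : Continuous (tensorCoords E v) := continuous_induced_dom
    fun_prop

theorem isClosed_tensorTopology_iff (v : Module.Basis ι ℂ V) (S : Set (E ⊗[ℂ] V)) :
    IsClosed[tensorTopology E V] S ↔ IsClosed (tensorCoords E v '' S) := by
  rw [tensorTopology_eq_induced v, isClosed_induced_iff]
  constructor
  · rintro ⟨T, hT, rfl⟩
    rwa [Set.image_preimage_eq T (tensorCoords E v).surjective]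
  · exact fun h => ⟨_, h, Set.preimage_image_eq S (tensorCoords E v).injective⟩

variable (E ι) in
/-- The dual of a finite power of `E`. -/
def dualPiEquiv [DecidableEq ι] : (ι → StrongDual ℂ E) ≃L[ℂ] StrongDual ℂ (ι → E) where
  toFun s := ∑ i, (s i).comp (ContinuousLinearMap.proj i)
  map_add' s t := by
    ext x
    simp [Finset.sum_add_distrib]
  map_smul' c s := by
    ext x
    simp [Finset.mul_sum]
  invFun ψ i := ψ.comp (ContinuousLinearMap.single ℂ (fun _ => E) i)
  left_inv s := by
    ext i x
    simp [Pi.single_apply, apply_ite]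
  right_inv ψ := by
    ext x
    conv_rhs => rw [← Finset.univ_sum_single x, map_sum]
    simp
  continuous_toFun := by fun_prop
  continuous_invFun := by fun_prop

@[simp]
theorem dualPiEquiv_apply [DecidableEq ι] (s : ι → StrongDual ℂ E) (x : ι → E) :
    dualPiEquiv E ι s x = ∑ i, s i (x i) := by
  simp [dualPiEquiv]

variable (E) in
/-- The pairing of `E ⊗ V` and `E* ⊗ W` induced by a pairing of `V` and `W`. -/
def tensorPairing (B : V →ₗ[ℂ] W →ₗ[ℂ] ℂ) :
    E ⊗[ℂ] V →ₗ[ℂ] StrongDual ℂ E ⊗[ℂ] W →ₗ[ℂ] ℂ :=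
  (TensorProduct.map₂ (ContinuousLinearMap.coeLM ℂ (M := E) (N₃ := ℂ)).flip B).compr₂
    (TensorProduct.lid ℂ ℂ).toLinearMap

@[simp]
theorem tensorPairing_tmul (B : V →ₗ[ℂ] W →ₗ[ℂ] ℂ) (e : E) (x : V) (ψ : StrongDual ℂ E) (y : W) :
    tensorPairing E B (e ⊗ₜ x) (ψ ⊗ₜ y) = ψ e * B x y := by
  simp [tensorPairing]

variable (E) in
/-- A perfect pairing of `V` and `W` makes `E* ⊗ W` the dual of `E ⊗ V`. -/
def tensorDuality [FiniteDimensional ℂ V] (B : V →ₗ[ℂ] W →ₗ[ℂ] ℂ) [B.IsPerfPair] :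
    BanachDuality (E ⊗[ℂ] V) (StrongDual ℂ E ⊗[ℂ] W) (Fin (Module.finrank ℂ V) → E)
      (tensorTopology E V) (tensorTopology (StrongDual ℂ E) W) where
  toBanach := tensorCoords E (Module.finBasis ℂ V)
  toDual := tensorCoords (StrongDual ℂ E)
      ((Module.finBasis ℂ V).dualBasis.map B.flip.toPerfPair.symm) ≪≫ₗ
    (dualPiEquiv E _).toLinearEquiv
  isClosed_left S := isClosed_tensorTopology_iff _ S
  isClosed_right S := by
    rw [isClosed_tensorTopology_iff
      ((Module.finBasis ℂ V).dualBasis.map B.flip.toPerfPair.symm)]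
    rw [← (dualPiEquiv E _).toHomeomorph.isClosed_image, Set.image_image]
    rfl

theorem tensorDuality_apply [FiniteDimensional ℂ V] (B : V →ₗ[ℂ] W →ₗ[ℂ] ℂ) [B.IsPerfPair]
    (m : E ⊗[ℂ] V) (s : StrongDual ℂ E ⊗[ℂ] W) :
    (tensorDuality E B).toDual s ((tensorDuality E B).toBanach m) = tensorPairing E B m s := by
  have h : (tensorDuality E B).toDual s ((tensorDuality E B).toBanach m) =
      ∑ i, tensorCoords (StrongDual ℂ E)
        ((Module.finBasis ℂ V).dualBasis.map B.flip.toPerfPair.symm) s i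
        (tensorCoords E (Module.finBasis ℂ V) m i) := by
    simp [tensorDuality]
  rw [h]
  clear h
  induction m with
  | zero => simp
  | add m m' hm hm' =>
    simp only [map_add, Pi.add_apply, LinearMap.add_apply, Finset.sum_add_distrib, hm, hm']
  | tmul e x =>
    induction s with
    | zero => simp
    | add s s' hs hs' =>
      simp only [map_add, Pi.add_apply, add_apply, Finset.sum_add_distrib, hs, hs']
    | tmul ψ y =>
      have hx : B x y = ∑ i, (Module.finBasis ℂ V).repr x i * B (Module.finBasis ℂ V i) y := by
        conv_lhs => rw [← (Module.finBasis ℂ V).sum_repr x]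
        simp only [map_sum, map_smul, LinearMap.sum_apply, LinearMap.smul_apply, smul_eq_mul]
      simp only [tensorPairing_tmul, tensorCoords_tmul, hx, Finset.mul_sum]
      refine Finset.sum_congr rfl fun i _ => ?_
      simp
      ring

end TensorDuality

/-! ### Contractions in the exterior algebra. -/

section Contraction

variable {V V' : Type*} [AddCommGroup V] [Module ℂ V] [AddCommGroup V'] [Module ℂ V']

/-- Contraction of the exterior algebra with a linear form. -/
def contract (φ : Module.Dual ℂ V) : ExteriorAlgebra ℂ V →ₗ[ℂ] ExteriorAlgebra ℂ V :=
  CliffordAlgebra.contractLeft φ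

theorem contract_algebraMap (φ : Module.Dual ℂ V) (c : ℂ) :
    contract φ (algebraMap ℂ _ c) = 0 :=
  CliffordAlgebra.contractLeft_algebraMap _ φ c

theorem contract_one (φ : Module.Dual ℂ V) : contract φ 1 = 0 :=
  CliffordAlgebra.contractLeft_one _ φ

theorem contract_ι_mul (φ : Module.Dual ℂ V) (y : V) (ω : ExteriorAlgebra ℂ V) :
    contract φ (ExteriorAlgebra.ι ℂ y * ω) = φ y • ω - ExteriorAlgebra.ι ℂ y * contract φ ω :=
  CliffordAlgebra.contractLeft_ι_mul φ y ω

theorem contract_map (φ : Module.Dual ℂ V) (τ : V' →ₗ[ℂ] V) (η : ExteriorAlgebra ℂ V') :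
    contract φ (ExteriorAlgebra.map τ η) = ExteriorAlgebra.map τ (contract (φ ∘ₗ τ) η) := by
  induction η using CliffordAlgebra.left_induction with
  | algebraMap r =>
    have h := contract_algebraMap (φ ∘ₗ τ) r
    have h' := contract_algebraMap φ r
    have h'' := (ExteriorAlgebra.map τ).commutes r
    exact (congrArg _ h'').trans (h'.trans ((congrArg _ h).trans (map_zero _)).symm)
  | add x y hx hy => simp only [map_add, hx, hy]
  | ι_mul x y hx =>
    change contract φ (ExteriorAlgebra.map τ (ExteriorAlgebra.ι ℂ y * x)) =
      ExteriorAlgebra.map τ (contract (φ ∘ₗ τ) (ExteriorAlgebra.ι ℂ y * x))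
    simp [contract_ι_mul, hx]

theorem contract_ιMulti (φ : Module.Dual ℂ V) (p : ℕ) (v : Fin (p + 1) → V) :
    contract φ (ExteriorAlgebra.ιMulti ℂ (p + 1) v) = ∑ k : Fin (p + 1),
      (-1 : ℤ) ^ (k : ℕ) • φ (v k) • ExteriorAlgebra.ιMulti ℂ p (k.removeNth v) := by
  induction p with
  | zero =>
    rw [ExteriorAlgebra.ιMulti_succ_apply, contract_ι_mul]
    simp [contract_one]
  | succ p ih =>
    rw [ExteriorAlgebra.ιMulti_succ_apply, contract_ι_mul, ih, Fin.sum_univ_succ (n := p + 1), Finset.mul_sum,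
      sub_eq_add_neg, ← Finset.sum_neg_distrib]
    congr 1
    · simp [Matrix.vecTail, Function.comp_def, Fin.tail]
    · refine Finset.sum_congr rfl fun k _ => ?_
      rw [ExteriorAlgebra.ιMulti_succ_apply]
      have h : Matrix.vecTail (k.succ.removeNth v) = k.removeNth (Matrix.vecTail v) := by
        ext j
        simp [Matrix.vecTail, Fin.removeNth]
      have h0 : k.succ.removeNth v 0 = v 0 := by simp [Fin.removeNth]
      rw [h, h0, mul_smul_comm, mul_smul_comm, Fin.val_succ, pow_succ, mul_neg_one, neg_smul]
      rfl

theorem ιMulti_mem (p : ℕ) (v : Fin p → V) : ExteriorAlgebra.ιMulti ℂ p v ∈ ⋀[ℂ]^p V :=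
  ExteriorAlgebra.ιMulti_range ℂ p (Set.mem_range_self v)

/-- Decomposable elements span. The motive carries the membership proof so that it can speak of
elements of the subtype. -/
theorem exteriorPower_induction {p : ℕ} {P : (ω : ExteriorAlgebra ℂ V) → ω ∈ ⋀[ℂ]^p V → Prop}
    (ιMulti : ∀ v : Fin p → V, P (ExteriorAlgebra.ιMulti ℂ p v) (ιMulti_mem p v))
    (zero : P 0 (Submodule.zero_mem _))
    (add : ∀ x y hx hy, P x hx → P y hy → P (x + y) (Submodule.add_mem _ hx hy))
    (smul : ∀ (c : ℂ) x hx, P x hx → P (c • x) (Submodule.smul_mem _ c hx))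
    {ω : ExteriorAlgebra ℂ V} (hω : ω ∈ ⋀[ℂ]^p V) : P ω hω := by
  have h := hω
  rw [← ExteriorAlgebra.ιMulti_span_fixedDegree] at h
  suffices ∃ h', P ω h' from this.2
  induction h using Submodule.span_induction with
  | mem x hx =>
    obtain ⟨v, rfl⟩ := hx
    exact ⟨_, ιMulti v⟩
  | zero => exact ⟨_, zero⟩
  | add x y hx hy hx' hy' =>
    rw [ExteriorAlgebra.ιMulti_span_fixedDegree] at hx hy
    obtain ⟨_, hx'⟩ := hx' hx
    obtain ⟨_, hy'⟩ := hy' hy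
    exact ⟨_, add x y _ _ hx' hy'⟩
  | smul c x hx hx' =>
    rw [ExteriorAlgebra.ιMulti_span_fixedDegree] at hx
    obtain ⟨_, hx'⟩ := hx' hx
    exact ⟨_, smul c x _ hx'⟩

theorem contract_mem (φ : Module.Dual ℂ V) {p : ℕ} {ω : ExteriorAlgebra ℂ V}
    (hω : ω ∈ ⋀[ℂ]^(p + 1) V) : contract φ ω ∈ ⋀[ℂ]^p V := by
  induction hω using exteriorPower_induction with
  | ιMulti v =>
    rw [contract_ιMulti]
    exact Submodule.sum_mem _ fun k _ =>
      zsmul_mem (Submodule.smul_mem _ _ (ιMulti_mem p _)) _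
  | zero => simp
  | add x y _ _ hx hy =>
    rw [map_add]
    exact Submodule.add_mem _ hx hy
  | smul c x _ hx =>
    rw [map_smul]
    exact Submodule.smul_mem _ c hx

variable {n : ℕ} (b : Module.Basis (Fin n) ℂ V)

/-- Euler's identity: peeling off the first factor contributes `1`, and the two sign changes in
passing it cancel. It recovers `ω` from its contractions when `p ≠ 0`. -/
theorem sum_ι_mul_contract {p : ℕ} {ω : ExteriorAlgebra ℂ V} (hω : ω ∈ ⋀[ℂ]^p V) :
    ∑ i, ExteriorAlgebra.ι ℂ (b i) * contract (b.coord i) ω = (p : ℂ) • ω := by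
  induction hω using exteriorPower_induction with
  | ιMulti v =>
    induction p with
    | zero => simp [contract_one]
    | succ p ih =>
      rw [ExteriorAlgebra.ιMulti_succ_apply]
      simp only [contract_ι_mul, mul_sub, Finset.sum_sub_distrib, mul_smul_comm]
      have h1 : ∑ i, b.coord i (v 0) • (ExteriorAlgebra.ι ℂ (b i) *
          ExteriorAlgebra.ιMulti ℂ p (Matrix.vecTail v)) =
          ExteriorAlgebra.ι ℂ (v 0) * ExteriorAlgebra.ιMulti ℂ p (Matrix.vecTail v) := by
        conv_rhs => rw [← b.sum_repr (v 0)]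
        simp only [map_sum, map_smul, Finset.sum_mul, smul_mul_assoc, Module.Basis.coord_apply]
      have h2 : ∀ i, ExteriorAlgebra.ι ℂ (b i) * (ExteriorAlgebra.ι ℂ (v 0) *
          contract (b.coord i) (ExteriorAlgebra.ιMulti ℂ p (Matrix.vecTail v))) =
          - (ExteriorAlgebra.ι ℂ (v 0) * (ExteriorAlgebra.ι ℂ (b i) *
          contract (b.coord i) (ExteriorAlgebra.ιMulti ℂ p (Matrix.vecTail v)))) := fun i => by
        rw [← mul_assoc, ← mul_assoc, eq_neg_of_add_eq_zero_left
          (ExteriorAlgebra.ι_add_mul_swap (b i) (v 0)), neg_mul]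
      simp only [h1, h2, Finset.sum_neg_distrib, ← Finset.mul_sum, ih]
      rw [mul_smul_comm, Nat.cast_succ, add_smul, one_smul, sub_neg_eq_add, add_comm]
  | zero => simp
  | add x y _ _ hx hy => simp only [map_add, mul_add, Finset.sum_add_distrib, hx, hy, smul_add]
  | smul c x _ hx => simp only [map_smul, mul_smul_comm, ← Finset.smul_sum, hx, smul_comm c]

/-! ### The Poincaré pairing of exterior powers. -/

/-- The coefficient of `b₁ ∧ ⋯ ∧ bₙ`. -/
def topCoeff : ExteriorAlgebra ℂ V →ₗ[ℂ] ℂ :=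
  ExteriorAlgebra.liftAlternating (Pi.single n b.det)

theorem topCoeff_ιMulti_basis : topCoeff b (ExteriorAlgebra.ιMulti ℂ n b) = 1 := by
  simp [topCoeff, b.det_self]

theorem topCoeff_ιMulti_of_ne {m : ℕ} (hm : m ≠ n) (v : Fin m → V) :
    topCoeff b (ExteriorAlgebra.ιMulti ℂ m v) = 0 := by
  simp [topCoeff, Pi.single_eq_of_ne hm]

theorem ιMulti_eq_zero_of_lt (b : Module.Basis (Fin n) ℂ V) {m : ℕ} (hm : n < m) (v : Fin m → V) :
    ExteriorAlgebra.ιMulti ℂ m v = 0 := by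
  refine AlternatingMap.map_linearDependent _ _ fun h => ?_
  have := b.finiteDimensional_of_finite
  have h' := h.fintype_card_le_finrank
  rw [Module.finrank_eq_card_basis b, Fintype.card_fin, Fintype.card_fin] at h'
  omega

/-- Only degree `n + 1` could contribute, and it is zero. -/
theorem topCoeff_contract (φ : Module.Dual ℂ V) (ω : ExteriorAlgebra ℂ V) :
    topCoeff b (contract φ ω) = 0 := by
  suffices h : topCoeff b ∘ₗ contract φ = 0 from LinearMap.congr_fun h ω
  ext m v
  change topCoeff b (contract φ (ExteriorAlgebra.ιMulti ℂ m v)) = 0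
  rcases m with _ | m
  · rw [ExteriorAlgebra.ιMulti_zero_apply, contract_one, map_zero]
  by_cases hm : m = n
  · rw [ιMulti_eq_zero_of_lt b (by omega), map_zero, map_zero]
  · rw [contract_ιMulti]
    simp only [map_sum, map_zsmul, map_smul, topCoeff_ιMulti_of_ne b hm, smul_zero,
      Finset.sum_const_zero]

/-- The reversal of products in the exterior algebra. -/
def rev : ExteriorAlgebra ℂ V →ₗ[ℂ] ExteriorAlgebra ℂ V := CliffordAlgebra.reverse

theorem rev_algebraMap (c : ℂ) : rev (algebraMap ℂ (ExteriorAlgebra ℂ V) c) = algebraMap ℂ _ c :=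
  CliffordAlgebra.reverse.commutes c

theorem rev_ι_mul (y : V) (ω : ExteriorAlgebra ℂ V) :
    rev (ExteriorAlgebra.ι ℂ y * ω) = rev ω * ExteriorAlgebra.ι ℂ y := by
  refine (CliffordAlgebra.reverse.map_mul _ _).trans ?_
  exact congrArg _ (CliffordAlgebra.reverse_ι y)

/-- The pairing `(ω, η) ↦` coefficient of `b₁ ∧ ⋯ ∧ bₙ` in the product of the reversal of `ω`
with `η`, where `η` is transported along `τ`. -/
def wedgePairing (τ : V' ≃ₗ[ℂ] V) :
    ExteriorAlgebra ℂ V →ₗ[ℂ] ExteriorAlgebra ℂ V' →ₗ[ℂ] ℂ :=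
  ((LinearMap.mul ℂ (ExteriorAlgebra ℂ V)).compl₁₂ rev
    (ExteriorAlgebra.map τ.toLinearMap).toLinearMap).compr₂ (topCoeff b)

theorem wedgePairing_apply (τ : V' ≃ₗ[ℂ] V) (ω : ExteriorAlgebra ℂ V) (η : ExteriorAlgebra ℂ V') :
    wedgePairing b τ ω η = topCoeff b (rev ω * ExteriorAlgebra.map τ.toLinearMap η) := rfl

theorem wedgePairing_ι_mul (τ : V' ≃ₗ[ℂ] V) (y : V') (ω : ExteriorAlgebra ℂ V)
    (η : ExteriorAlgebra ℂ V') :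
    wedgePairing b τ (ExteriorAlgebra.ι ℂ (τ y) * ω) η =
      wedgePairing b τ ω (ExteriorAlgebra.ι ℂ y * η) := by
  simp [wedgePairing_apply, rev_ι_mul, mul_assoc]

/-- Integration by parts: factors of `ω` move one by one onto `η`, and on scalars the claim is that
a contraction has no top coefficient. The reversal absorbs the signs. -/
theorem topCoeff_rev_contract_mul (φ : Module.Dual ℂ V) (ω η : ExteriorAlgebra ℂ V) :
    topCoeff b (rev (contract φ ω) * η) = topCoeff b (rev ω * contract φ η) := by
  induction ω using CliffordAlgebra.left_induction generalizing η with
  | algebraMap r =>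
    have h := contract_algebraMap φ r
    have h' := rev_algebraMap (V := V) r
    erw [h, h']
    rw [map_zero, zero_mul, map_zero, ← Algebra.smul_def, map_smul, topCoeff_contract, smul_zero]
  | add x y hx hy => simp only [map_add, add_mul, hx, hy]
  | ι_mul x y hx =>
    change topCoeff b (rev (contract φ (ExteriorAlgebra.ι ℂ y * x)) * η) =
      topCoeff b (rev (ExteriorAlgebra.ι ℂ y * x) * contract φ η)
    have h := hx (ExteriorAlgebra.ι ℂ y * η)
    rw [contract_ι_mul, mul_sub, map_sub, mul_smul_comm, map_smul] at h
    rw [contract_ι_mul, map_sub, map_smul, rev_ι_mul, rev_ι_mul, sub_mul, map_sub, mul_assoc, h,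
      smul_mul_assoc, map_smul, mul_assoc]
    ring

theorem wedgePairing_contract (τ : V' ≃ₗ[ℂ] V) (φ : Module.Dual ℂ V) (ω : ExteriorAlgebra ℂ V)
    (η : ExteriorAlgebra ℂ V') :
    wedgePairing b τ (contract φ ω) η =
      wedgePairing b τ ω (contract (φ ∘ₗ τ.toLinearMap) η) := by
  rw [wedgePairing_apply, wedgePairing_apply, topCoeff_rev_contract_mul, contract_map]

/-- Induction on `p`: all contractions of `ω` also pair to zero, hence vanish, and Euler's identity
gives `(p + 1) • ω = 0`. A scalar is tested against the top element. -/
theorem eq_zero_of_wedgePairing_eq_zero (τ : V' ≃ₗ[ℂ] V) {p q : ℕ} (hpq : p + q = n)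
    {ω : ExteriorAlgebra ℂ V} (hω : ω ∈ ⋀[ℂ]^p V)
    (h : ∀ η ∈ ⋀[ℂ]^q V', wedgePairing b τ ω η = 0) : ω = 0 := by
  induction p generalizing q ω with
  | zero =>
    obtain rfl : q = n := by omega
    rw [ExteriorAlgebra.exteriorPower, pow_zero, Submodule.mem_one] at hω
    obtain ⟨c, rfl⟩ := hω
    have := h (ExteriorAlgebra.ιMulti ℂ q (τ.symm ∘ b)) (ιMulti_mem q _)
    rw [wedgePairing_apply, rev_algebraMap, ExteriorAlgebra.map_apply_ιMulti,
      ← Algebra.smul_def, map_smul] at this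
    have h' : ⇑τ.toLinearMap ∘ ⇑τ.symm ∘ ⇑b = b := by
      ext i
      simp
    rw [h', topCoeff_ιMulti_basis, smul_eq_mul, mul_one] at this
    rw [this, map_zero]
  | succ p ih =>
    have h0 : ∀ i, contract (b.coord i) ω = 0 := fun i =>
      ih (q := q + 1) (by omega) (contract_mem _ hω) fun η hη => by
        rw [wedgePairing_contract]
        exact h _ (contract_mem _ hη)
    have h1 := sum_ι_mul_contract b hω
    simp only [h0, mul_zero, Finset.sum_const_zero] at h1
    exact (smul_eq_zero.mp h1.symm).resolve_left (by exact_mod_cast p.succ_ne_zero)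

/-- The pairing of `⋀^p V` and `⋀^q V'`. -/
def exteriorPairing (τ : V' ≃ₗ[ℂ] V) (p q : ℕ) : ⋀[ℂ]^p V →ₗ[ℂ] ⋀[ℂ]^q V' →ₗ[ℂ] ℂ :=
  (wedgePairing b τ).domRestrict₁₂ (⋀[ℂ]^p V) (⋀[ℂ]^q V')

theorem exteriorPairing_apply (τ : V' ≃ₗ[ℂ] V) (p q : ℕ) (ω : ⋀[ℂ]^p V) (η : ⋀[ℂ]^q V') :
    exteriorPairing b τ p q ω η = wedgePairing b τ ω η := rfl

theorem exteriorPairing_isPerfPair (τ : V' ≃ₗ[ℂ] V) {p q : ℕ} (hpq : p + q = n) :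
    (exteriorPairing b τ p q).IsPerfPair := by
  have := b.finiteDimensional_of_finite
  have := (b.map τ.symm).finiteDimensional_of_finite
  have hinj : Function.Injective (exteriorPairing b τ p q) := by
    rw [injective_iff_map_eq_zero]
    intro ω hω
    refine Subtype.ext (eq_zero_of_wedgePairing_eq_zero b τ hpq ω.2 fun η hη => ?_)
    exact LinearMap.congr_fun hω ⟨η, hη⟩
  refine LinearMap.IsPerfPair.of_bijective _ ⟨hinj, ?_⟩
  rw [← LinearMap.injective_iff_surjective_of_finrank_eq_finrank]
  · exact hinj
  · rw [Subspace.dual_finrank_eq, exteriorPower.finrank_eq, exteriorPower.finrank_eq,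
      Module.finrank_eq_card_basis b, Module.finrank_eq_card_basis (b.map τ.symm),
      Fintype.card_fin]
    exact Nat.choose_symm_of_eq_add hpq.symm

end Contraction

/-! ### The differential in terms of contractions, and the trace term. -/

section Boundary

variable {L E : Type*} [LieRing L] [LieAlgebra ℂ L] [NormedAddCommGroup E] [NormedSpace ℂ E]
  {n : ℕ} (b : Module.Basis (Fin n) ℂ L)

/-- Contraction with a linear form, between exterior powers. -/
def contractPow {V : Type*} [AddCommGroup V] [Module ℂ V] (φ : Module.Dual ℂ V) (p : ℕ) :
    ⋀[ℂ]^(p + 1) V →ₗ[ℂ] ⋀[ℂ]^p V :=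
  (contract φ).restrict fun _ h => contract_mem φ h

theorem contractPow_ιMulti {V : Type*} [AddCommGroup V] [Module ℂ V] (φ : Module.Dual ℂ V) (p : ℕ)
    (v : Fin (p + 1) → V) :
    contractPow φ p (exteriorPower.ιMulti ℂ (p + 1) v) = ∑ k : Fin (p + 1),
      (-1 : ℤ) ^ (k : ℕ) • φ (v k) • exteriorPower.ιMulti ℂ p (k.removeNth v) := by
  apply Subtype.ext
  refine (contract_ιMulti φ p v).trans ?_
  simp [exteriorPower.ιMulti_apply_coe]

/-- Expanding each `vₖ` in the basis turns the sum over positions into one over basis vectors, a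
form that can cross the pairing. -/
theorem actionPart_apply (ρ : RightAction L E) (f : Module.Dual ℂ L) (p : ℕ) (e : E)
    (ω : ⋀[ℂ]^(p + 1) L) :
    actionPart ρ f p e ω = ∑ i, shifted ρ f (b i) e ⊗ₜ[ℂ] contractPow (b.coord i) p ω := by
  suffices h : actionPart ρ f p e = ∑ i, TensorProduct.mk ℂ E _ (shifted ρ f (b i) e) ∘ₗ
      contractPow (b.coord i) p by
    rw [h]
    simp
  ext v
  have h : ∀ y, shifted ρ f y e = ∑ i, b.coord i y • shifted ρ f (b i) e := fun y => by
    conv_lhs => rw [← b.sum_repr y]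
    simp only [map_sum, map_smul, LinearMap.sum_apply, LinearMap.smul_apply,
      Module.Basis.coord_apply]
  simp only [LinearMap.compAlternatingMap_apply, LinearMap.sum_apply, LinearMap.comp_apply,
    contractPow_ιMulti, map_sum, map_zsmul, map_smul]
  rw [Finset.sum_comm]
  simp only [actionPart, LinearMap.coe_mk, AddHom.coe_mk,
    exteriorPower.alternatingMapLinearEquiv_apply_ιMulti,
    AlternatingMap.alternatizeUncurryFin_apply, LinearMap.compAlternatingMap_apply]
  refine Finset.sum_congr rfl fun k _ => ?_
  rw [h (v k), ← Finset.smul_sum]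
  congr 1
  simp [TensorProduct.smul_tmul']

/-- The bracket part of the boundary in terms of contractions. -/
def bracketOp (ω : ExteriorAlgebra ℂ L) : ExteriorAlgebra ℂ L :=
  (-(1 / 2) : ℂ) • ∑ i, ∑ j, ExteriorAlgebra.ι ℂ ⁅b i, b j⁆ *
    contract (b.coord j) (contract (b.coord i) ω)

theorem ι_lie_mul_eq_sum (x y : L) (ω : ExteriorAlgebra ℂ L) :
    ExteriorAlgebra.ι ℂ ⁅x, y⁆ * ω = ∑ i, ∑ j, b.coord i x • b.coord j y •
      (ExteriorAlgebra.ι ℂ ⁅b i, b j⁆ * ω) := by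
  have h : ⁅x, y⁆ = ∑ i, ∑ j, b.coord i x • b.coord j y • ⁅b i, b j⁆ := by
    conv_lhs => rw [← b.sum_repr x, ← b.sum_repr y]
    simp only [sum_lie, lie_sum, smul_lie, lie_smul, Module.Basis.coord_apply]
    simp only [Finset.smul_sum]
    rw [Finset.sum_comm]
    exact Finset.sum_congr rfl fun i _ => Finset.sum_congr rfl fun j _ => by rw [smul_comm]
  rw [h]
  simp only [map_sum, map_smul, Finset.sum_mul, smul_mul_assoc]

theorem coe_bracketPart (p : ℕ) (ω : ⋀[ℂ]^(p + 1) L) :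
    (bracketPart L p ω : ExteriorAlgebra ℂ L) = bracketOp b ω := by
  obtain ⟨ω, hω⟩ := ω
  induction hω using exteriorPower_induction with
  | zero =>
    have : (⟨0, Submodule.zero_mem _⟩ : ⋀[ℂ]^(p + 1) L) = 0 := rfl
    rw [this]
    simp [bracketOp]
  | add x y hx hy hx' hy' =>
    have : (⟨x + y, Submodule.add_mem _ hx hy⟩ : ⋀[ℂ]^(p + 1) L) = ⟨x, hx⟩ + ⟨y, hy⟩ := rfl
    rw [this, map_add, Submodule.coe_add, hx', hy', Submodule.coe_add]
    simp only [bracketOp, map_add, mul_add, Finset.sum_add_distrib, smul_add]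
  | smul c x hx hx' =>
    have : (⟨c • x, Submodule.smul_mem _ c hx⟩ : ⋀[ℂ]^(p + 1) L) = c • ⟨x, hx⟩ := rfl
    rw [this, map_smul, Submodule.coe_smul, hx', Submodule.coe_smul]
    simp only [bracketOp, map_smul, mul_smul_comm, ← Finset.smul_sum, smul_comm c]
  | ιMulti v =>
    cases p with
    | zero =>
      have h : ∀ i j, contract (b.coord j) (contract (b.coord i)
          (ExteriorAlgebra.ιMulti ℂ 1 v)) = 0 := fun i j => by
        rw [contract_ιMulti]
        simp [contract_one]
      simp only [bracketPart, bracketOp, LinearMap.zero_apply]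
      simp only [h, mul_zero, Finset.sum_const_zero, smul_zero, Submodule.coe_zero]
    | succ p =>
      have hb : ∀ (y z : L) (w : Fin p → L), (bracketWedge L p y z w : ExteriorAlgebra ℂ L) =
          ExteriorAlgebra.ι ℂ ⁅y, z⁆ * ExteriorAlgebra.ιMulti ℂ p w := fun y z w => by
        change ExteriorAlgebra.ιMulti ℂ (p + 1) (Matrix.vecCons ⁅y, z⁆ w) = _
        simp [ExteriorAlgebra.ιMulti_succ_apply]
      change (bracketPart L (p + 1) (exteriorPower.ιMulti ℂ (p + 2) v) : ExteriorAlgebra ℂ L) =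
        bracketOp b (ExteriorAlgebra.ιMulti ℂ (p + 2) v)
      rw [bracketPart, exteriorPower.alternatingMapLinearEquiv_apply_ιMulti,
        AlternatingMap.smul_apply, Submodule.coe_smul, bracketOp]
      congr 1
      simp only [AlternatingMap.alternatizeUncurryFin_apply, LinearMap.comp_apply,
        AlternatingMap.alternatizeUncurryFinLM_apply, contract_ιMulti, map_sum, map_zsmul,
        map_smul]
      simp only [AddSubmonoidClass.coe_finsetSum, Submodule.coe_smul_of_tower, hb,
        ι_lie_mul_eq_sum b (v _), Finset.smul_sum, Finset.mul_sum]
      -- After expanding `[vₖ, vₗ]` in the basis, the sums over basis indices move outside the sums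
      -- over positions.
      rw [Finset.sum_congr rfl fun k _ => Finset.sum_comm, Finset.sum_comm]
      refine Finset.sum_congr rfl fun i _ => ?_
      rw [Finset.sum_congr rfl fun k _ => Finset.sum_comm, Finset.sum_comm]
      refine Finset.sum_congr rfl fun j _ => Finset.sum_congr rfl fun k _ =>
        Finset.sum_congr rfl fun l _ => ?_
      simp only [mul_smul_comm]
      rw [smul_comm (b.coord i (v k)) ((-1 : ℤ) ^ (l : ℕ))]

theorem boundary_tmul (ρ : RightAction L E) (f : Module.Dual ℂ L) (p : ℕ) (e : E)
    (ω : ⋀[ℂ]^(p + 1) L) :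
    boundary ρ f p (e ⊗ₜ ω) = ∑ i, shifted ρ f (b i) e ⊗ₜ[ℂ] contractPow (b.coord i) p ω +
      e ⊗ₜ bracketPart L p ω := by
  rw [boundary, LinearMap.add_apply, TensorProduct.lift.tmul, actionPart_apply b,
    LinearMap.lTensor_tmul]

/-- The trace of the adjoint operators, in a basis. -/
theorem trace_ad_eq_sum (x : L) :
    LinearMap.trace ℂ L (LieModule.toEnd ℂ L L x) = ∑ j, b.coord j ⁅x, b j⁆ := by
  rw [LinearMap.trace_eq_matrix_trace ℂ b, Matrix.trace]
  simp [LinearMap.toMatrix_apply]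

variable {L' : Type*} [LieRing L'] [LieAlgebra ℂ L']

theorem contract_contract_ι_mul {V : Type*} [AddCommGroup V] [Module ℂ V] (φ ψ : Module.Dual ℂ V)
    (y : V) (η : ExteriorAlgebra ℂ V) :
    contract φ (contract ψ (ExteriorAlgebra.ι ℂ y * η)) =
      ψ y • contract φ η - φ y • contract ψ η +
        ExteriorAlgebra.ι ℂ y * contract φ (contract ψ η) := by
  rw [contract_ι_mul, map_sub, map_smul, contract_ι_mul]
  abel

/-- On the right the contractions act after the multiplication by a bracket. Commuting them back
yields two equal trace sums, by skew-symmetry of the bracket, and the factor `-1/2` turns their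
total into minus one such sum. -/
theorem wedgePairing_bracketOp (τ : L' ≃ₗ[ℂ] L) (hτ : ∀ x y, τ ⁅x, y⁆ = ⁅τ y, τ x⁆)
    (ω : ExteriorAlgebra ℂ L) (η : ExteriorAlgebra ℂ L') :
    wedgePairing b τ (bracketOp b ω) η = wedgePairing b τ ω (bracketOp (b.map τ.symm) η) -
      ∑ i, LinearMap.trace ℂ L (LieModule.toEnd ℂ L L (b i)) *
        wedgePairing b τ ω (contract ((b.map τ.symm).coord i) η) := by
  set b' := b.map τ.symm with hb'
  have hc : ∀ i, b.coord i ∘ₗ τ.toLinearMap = b'.coord i := fun i => by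
    ext y
    simp [hb']
  have hc' : ∀ i y, b'.coord i y = b.coord i (τ y) := fun i y => by
    rw [← hc]
    rfl
  have hl : ∀ i j, ⁅b i, b j⁆ = τ ⁅b' j, b' i⁆ := fun i j => by
    rw [hτ]
    simp [hb']
  have h1 : ∀ i j, wedgePairing b τ (ExteriorAlgebra.ι ℂ ⁅b i, b j⁆ *
      contract (b.coord j) (contract (b.coord i) ω)) η =
      wedgePairing b τ ω (contract (b'.coord i) (contract (b'.coord j)
        (ExteriorAlgebra.ι ℂ ⁅b' j, b' i⁆ * η))) := fun i j => by
    rw [hl, wedgePairing_ι_mul, wedgePairing_contract, wedgePairing_contract, hc, hc]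
  have h2 : ∑ i, ∑ j, contract (b'.coord i) (contract (b'.coord j)
        (ExteriorAlgebra.ι ℂ ⁅b' j, b' i⁆ * η)) =
      (2 : ℂ) • ∑ i, LinearMap.trace ℂ L (LieModule.toEnd ℂ L L (b i)) •
        contract (b'.coord i) η + ∑ i, ∑ j, ExteriorAlgebra.ι ℂ ⁅b' i, b' j⁆ *
          contract (b'.coord j) (contract (b'.coord i) η) := by
    simp only [contract_contract_ι_mul, Finset.sum_add_distrib, Finset.sum_sub_distrib]
    congr 1
    · have e1 : ∑ i, ∑ j, b'.coord j ⁅b' j, b' i⁆ • contract (b'.coord i) η =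
          ∑ i, LinearMap.trace ℂ L (LieModule.toEnd ℂ L L (b i)) • contract (b'.coord i) η := by
        refine Finset.sum_congr rfl fun i _ => ?_
        rw [← Finset.sum_smul, trace_ad_eq_sum b]
        simp only [hc', ← hl]
      have e2 : ∑ i, ∑ j, b'.coord i ⁅b' j, b' i⁆ • contract (b'.coord j) η =
          - ∑ i, LinearMap.trace ℂ L (LieModule.toEnd ℂ L L (b i)) • contract (b'.coord i) η := by
        rw [Finset.sum_comm, ← Finset.sum_neg_distrib]
        refine Finset.sum_congr rfl fun i _ => ?_
        rw [← Finset.sum_smul, trace_ad_eq_sum b, ← neg_smul, ← Finset.sum_neg_distrib]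
        congr 1
        refine Finset.sum_congr rfl fun j _ => ?_
        rw [hc', ← hl, ← lie_skew, map_neg]
      rw [e1, e2, two_smul, sub_neg_eq_add]
    · rw [Finset.sum_comm]
  have h3 : wedgePairing b τ (bracketOp b ω) η = (-(1 / 2) : ℂ) • wedgePairing b τ ω
      (∑ i, ∑ j, contract (b'.coord i) (contract (b'.coord j)
        (ExteriorAlgebra.ι ℂ ⁅b' j, b' i⁆ * η))) := by
    simp only [bracketOp, map_smul, map_sum, LinearMap.smul_apply, LinearMap.sum_apply, h1]
  rw [h3, h2, bracketOp]
  simp only [map_add, map_smul, map_sum, smul_eq_mul]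
  ring

end Boundary

/-! ### Adjointness of the two complexes. -/

section Duality

variable {L E : Type*} [LieRing L] [LieAlgebra ℂ L] [NormedAddCommGroup E] [NormedSpace ℂ E]
  {n : ℕ} (b : Module.Basis (Fin n) ℂ L)

variable (L) in
/-- The linear form `x ↦ trace (ad x)` on `L`. -/
def traceAd : Module.Dual ℂ L :=
  LinearMap.trace ℂ L ∘ₗ (LieModule.toEnd ℂ L L : L →ₗ[ℂ] Module.End ℂ L)

/-- The linear form `f + trace ∘ ad` on `L'`. -/
def dualForm (f : Module.Dual ℂ L) : Module.Dual ℂ (Opposite L) :=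
  (f + traceAd L) ∘ₗ (toOpposite L).symm.toLinearMap

/-- The differential for `L'` acting on `E*` is adjoint to that for `L` acting on `E`. -/
theorem tensorPairing_boundary (ρ : RightAction L E) (f : Module.Dual ℂ L) (p q : ℕ)
    (m : E ⊗[ℂ] ⋀[ℂ]^(p + 1) L) (s : StrongDual ℂ E ⊗[ℂ] ⋀[ℂ]^(q + 1) (Opposite L)) :
    tensorPairing E (exteriorPairing b (toOpposite L).symm p (q + 1)) (boundary ρ f p m) s =
      tensorPairing E (exteriorPairing b (toOpposite L).symm (p + 1) q) m
        (boundary ρ.adjoint (dualForm f) q s) := by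
  induction m with
  | zero => simp
  | add m m' hm hm' => simp only [map_add, LinearMap.add_apply, hm, hm']
  | tmul e ω =>
  induction s with
  | zero => simp
  | add s s' hs hs' => simp only [map_add, hs, hs']
  | tmul ψ η =>
  have h1 : ∀ i, (b.coord i) ∘ₗ (toOpposite L).symm.toLinearMap =
      (b.map (toOpposite L)).coord i := fun i => rfl
  have h2 : ∀ i (e : E), shifted ρ.adjoint (dualForm f) (b.map (toOpposite L) i) ψ e =
      ψ (shifted ρ f (b i) e) - LinearMap.trace ℂ L (LieModule.toEnd ℂ L L (b i)) * ψ e := by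
    intro i e
    have : dualForm f (b.map (toOpposite L) i) =
        f (b i) + LinearMap.trace ℂ L (LieModule.toEnd ℂ L L (b i)) := rfl
    have h := ρ.adjoint_op_apply (b i) ψ e
    simp only [shifted, LinearMap.coe_mk, AddHom.coe_mk, LinearMap.sub_apply, this]
    simp only [Module.Basis.map_apply, LinearMap.smul_apply, LinearMap.id_apply, sub_apply,
      smul_apply, ContinuousLinearMap.coe_coe, map_sub, map_smul, smul_eq_mul, h]
    ring
  rw [boundary_tmul b, boundary_tmul (b.map (toOpposite L))]
  simp only [map_add, map_sum, LinearMap.add_apply, LinearMap.sum_apply, tensorPairing_tmul,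
    exteriorPairing_apply, coe_bracketPart b, coe_bracketPart (b.map (toOpposite L)), h2]
  have h3 : ∀ i, wedgePairing b (toOpposite L).symm (contractPow (b.coord i) p ω) η =
      wedgePairing b (toOpposite L).symm ω
        (contractPow ((b.map (toOpposite L)).coord i) q η) := fun i => by
    rw [← h1]
    exact wedgePairing_contract b _ _ _ _
  have h4 := wedgePairing_bracketOp b (toOpposite L).symm (fun x y => rfl) ω η
  rw [LinearEquiv.symm_symm] at h4
  rw [h4]
  simp only [h3, sub_mul, Finset.sum_sub_distrib, mul_sub, Finset.mul_sum]
  have h5 : ∀ i, ψ e * (LinearMap.trace ℂ L (LieModule.toEnd ℂ L L (b i)) *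
      wedgePairing b (toOpposite L).symm ω (contract ((b.map (toOpposite L)).coord i) η)) =
      LinearMap.trace ℂ L (LieModule.toEnd ℂ L L (b i)) * ψ e *
      wedgePairing b (toOpposite L).symm ω
        (contractPow ((b.map (toOpposite L)).coord i) q η) := fun i => by
    rw [contractPow, LinearMap.coe_restrict_apply]
    ring
  simp only [h5]
  ring

/-- `E* ⊗ ⋀^q L'` as the dual of `E ⊗ ⋀^p L`. -/
def exteriorDuality (E : Type*) [NormedAddCommGroup E] [NormedSpace ℂ E] {p q : ℕ}
    (hpq : p + q = n) :
    BanachDuality (E ⊗[ℂ] ⋀[ℂ]^p L) (StrongDual ℂ E ⊗[ℂ] ⋀[ℂ]^q (Opposite L))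
      (Fin (Module.finrank ℂ (⋀[ℂ]^p L)) → E) (tensorTopology E (⋀[ℂ]^p L))
      (tensorTopology (StrongDual ℂ E) (⋀[ℂ]^q (Opposite L))) :=
  haveI := b.finiteDimensional_of_finite
  haveI := exteriorPairing_isPerfPair b (toOpposite L).symm hpq
  tensorDuality E (exteriorPairing b (toOpposite L).symm p q)

theorem isAdjoint_boundary (ρ : RightAction L E) (f : Module.Dual ℂ L) {p q : ℕ}
    (hpq : p + (q + 1) = n) (hpq' : (p + 1) + q = n) :
    BanachDuality.IsAdjoint (exteriorDuality b E hpq') (exteriorDuality b E hpq)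
      (boundary ρ f p) (boundary ρ.adjoint (dualForm f) q) := by
  have := b.finiteDimensional_of_finite
  have := exteriorPairing_isPerfPair b (toOpposite L).symm hpq
  have := exteriorPairing_isPerfPair b (toOpposite L).symm hpq'
  intro m s
  exact (tensorDuality_apply _ _ _).trans
    ((tensorPairing_boundary b ρ f p q m s).symm.trans (tensorDuality_apply _ _ _).symm)

/-! ### Transfer of closed ranges and exactness, including the end degrees. -/

theorem exteriorPower_subsingleton_of_lt (b : Module.Basis (Fin n) ℂ L) {m : ℕ} (hm : n < m) : Subsingleton (⋀[ℂ]^m L) := by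
  have := b.finiteDimensional_of_finite
  rw [← Module.finrank_zero_iff (R := ℂ), exteriorPower.finrank_eq,
    Module.finrank_eq_card_basis b, Fintype.card_fin]
  exact Nat.choose_eq_zero_of_lt hm

theorem range_boundary_eq_bot_of_le (b : Module.Basis (Fin n) ℂ L) (ρ : RightAction L E)
    (f : Module.Dual ℂ L) {m : ℕ} (hm : n ≤ m) : LinearMap.range (boundary ρ f m) = ⊥ := by
  have := exteriorPower_subsingleton_of_lt b (Nat.lt_succ_of_le hm)
  rw [LinearMap.range_eq_bot]
  ext e v
  have : exteriorPower.ιMulti ℂ (m + 1) v = 0 := Subsingleton.elim _ _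
  simp [this]

theorem isClosed_bot_tensorTopology (E V : Type*) [NormedAddCommGroup E] [NormedSpace ℂ E]
    [AddCommGroup V] [Module ℂ V] [FiniteDimensional ℂ V] :
    IsClosed[tensorTopology E V] ((⊥ : Submodule ℂ (E ⊗[ℂ] V)) : Set (E ⊗[ℂ] V)) := by
  rw [isClosed_tensorTopology_iff (Module.finBasis ℂ V)]
  simp

theorem hasClosedRange_zero [FiniteDimensional ℂ L] (ρ : RightAction L E) (f : Module.Dual ℂ L) :
    HasClosedRange ρ f 0 := by
  rw [HasClosedRange, d, LinearMap.range_zero]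
  exact isClosed_bot_tensorTopology _ _

theorem hasClosedRange_iff_adjoint [CompleteSpace E] (b : Module.Basis (Fin n) ℂ L)
    (ρ : RightAction L E) (f : Module.Dual ℂ L) {p q : ℕ} (hpq : p + q = n) :
    HasClosedRange ρ f (p + 1) ↔ HasClosedRange ρ.adjoint (dualForm f) q := by
  have := b.finiteDimensional_of_finite
  have := (b.map (toOpposite L)).finiteDimensional_of_finite
  cases q with
  | zero =>
    -- Here `p = n`, so both differentials have range zero.
    refine iff_of_true ?_ (hasClosedRange_zero _ _)
    rw [HasClosedRange, d, range_boundary_eq_bot_of_le b ρ f (by omega)]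
    exact isClosed_bot_tensorTopology _ _
  | succ q => exact (isAdjoint_boundary b ρ f hpq (by omega)).isClosed_range_iff

/-- The range is the kernel of a bounded operator. -/
theorem hasClosedRange_of_exact [CompleteSpace E] (b : Module.Basis (Fin n) ℂ L)
    (ρ : RightAction L E) (f : Module.Dual ℂ L) {p : ℕ} (hp : p ≤ n)
    (h : LinearMap.range (d ρ f (p + 1)) = LinearMap.ker (d ρ f p)) :
    HasClosedRange ρ f (p + 1) := by
  rw [HasClosedRange, h]
  cases p with
  | zero =>
    rw [d, LinearMap.ker_zero]
    exact @isClosed_univ _ (tensorTopology E _)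
  | succ p =>
    exact (isAdjoint_boundary b ρ f (q := n - (p + 1)) (by omega) (by omega)).isClosed_ker

theorem range_d_adjoint_eq_ker [CompleteSpace E] (b : Module.Basis (Fin n) ℂ L)
    (ρ : RightAction L E) (f : Module.Dual ℂ L) {p q : ℕ} (hpq : p + q = n)
    (hcl : HasClosedRange ρ f p)
    (h : LinearMap.range (d ρ f (p + 1)) = LinearMap.ker (d ρ f p)) :
    LinearMap.range (d ρ.adjoint (dualForm f) (q + 1)) =
      LinearMap.ker (d ρ.adjoint (dualForm f) q) := by
  -- At the ends of the complex, `d_0` and `d_(n+1)` are not matched by `isAdjoint_boundary`; the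
  -- zero endomorphism, adjoint to itself, replaces them.
  have h0 : BanachDuality.IsAdjoint (exteriorDuality b E hpq) (exteriorDuality b E hpq) 0 0 :=
    BanachDuality.isAdjoint_zero
  rcases p with _ | p <;> rcases q with _ | q
  · rw [d, d, range_boundary_eq_bot_of_le b ρ f (by omega)] at h
    rw [d, d, range_boundary_eq_bot_of_le (b.map (toOpposite L)) _ _ (by omega)]
    exact LinearMap.range_zero.symm.trans
      (h0.range_eq_ker_right h0 hcl (LinearMap.range_zero.trans h))
  · rw [d, d] at h
    rw [d, d, range_boundary_eq_bot_of_le (b.map (toOpposite L)) _ _ (by omega)]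
    exact LinearMap.range_zero.symm.trans
      ((isAdjoint_boundary b ρ f hpq (by omega)).range_eq_ker_right h0 hcl h)
  · rw [d, d, range_boundary_eq_bot_of_le b ρ f (by omega)] at h
    exact h0.range_eq_ker_right (isAdjoint_boundary b ρ f (q := 0) (by omega) hpq) hcl
      (LinearMap.range_zero.trans h)
  · exact (isAdjoint_boundary b ρ f hpq (by omega)).range_eq_ker_right
      (isAdjoint_boundary b ρ f (by omega) hpq) hcl h

theorem range_d_eq_ker_of_adjoint [CompleteSpace E] (b : Module.Basis (Fin n) ℂ L)
    (ρ : RightAction L E) (f : Module.Dual ℂ L) {p q : ℕ} (hpq : p + q = n)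
    (hcl : HasClosedRange ρ f (p + 1))
    (h : LinearMap.range (d ρ.adjoint (dualForm f) (q + 1)) =
      LinearMap.ker (d ρ.adjoint (dualForm f) q)) :
    LinearMap.range (d ρ f (p + 1)) = LinearMap.ker (d ρ f p) := by
  have h0 : BanachDuality.IsAdjoint (exteriorDuality b E hpq) (exteriorDuality b E hpq) 0 0 :=
    BanachDuality.isAdjoint_zero
  have := b.finiteDimensional_of_finite
  have hz : IsClosed[tensorTopology E (⋀[ℂ]^p L)]
      (LinearMap.range (0 : E ⊗[ℂ] ⋀[ℂ]^p L →ₗ[ℂ] E ⊗[ℂ] ⋀[ℂ]^p L) : Set _) := by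
    rw [LinearMap.range_zero]
    exact isClosed_bot_tensorTopology _ _
  rcases p with _ | p <;> rcases q with _ | q
  · rw [d, d, range_boundary_eq_bot_of_le (b.map (toOpposite L)) _ _ (by omega)] at h
    rw [d, d, range_boundary_eq_bot_of_le b ρ f (by omega)]
    exact LinearMap.range_zero.symm.trans
      (h0.range_eq_ker_left h0 hz (LinearMap.range_zero.trans h))
  · rw [d, d, range_boundary_eq_bot_of_le (b.map (toOpposite L)) _ _ (by omega)] at h
    exact (isAdjoint_boundary b ρ f hpq (by omega)).range_eq_ker_left h0 hcl
      (LinearMap.range_zero.trans h)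
  · rw [d, d] at h
    rw [d, d, range_boundary_eq_bot_of_le b ρ f (by omega)]
    exact LinearMap.range_zero.symm.trans
      (h0.range_eq_ker_left (isAdjoint_boundary b ρ f (q := 0) (by omega) hpq) hz h)
  · exact (isAdjoint_boundary b ρ f hpq (by omega)).range_eq_ker_left
      (isAdjoint_boundary b ρ f (by omega) hpq) hcl h

/-! ### Characters, spectra and the translation by the trace. -/

theorem traceAd_lie (x y : L) : traceAd L ⁅x, y⁆ = 0 := by
  simp [traceAd, Ring.lie_def, LinearMap.trace_mul_comm]

theorem dualForm_mem_characters_iff (f : Module.Dual ℂ L) :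
    dualForm f ∈ characters (Opposite L) ↔ f ∈ characters L := by
  have h : ∀ x y : L, dualForm f ⁅toOpposite L x, toOpposite L y⁆ = f ⁅y, x⁆ := fun x y => by
    rw [lie_toOpposite]
    simp [dualForm, traceAd_lie]
  constructor
  · intro hf x y
    rw [← h]
    exact hf _ _
  · intro hf x y
    exact (h x y).trans (hf _ _)

theorem mem_sigmaDelta_iff [CompleteSpace E] (b : Module.Basis (Fin n) ℂ L)
    (ρ : RightAction L E) (f : Module.Dual ℂ L) {k : ℕ} (hk : k ≤ n) :
    f ∈ sigmaDelta ρ k ↔ dualForm f ∈ sigmaPi ρ.adjoint (n - k) := by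
  have := b.finiteDimensional_of_finite
  have hn : Module.finrank ℂ (Opposite L) = n := by
    rw [Module.finrank_eq_card_basis (b.map (toOpposite L)), Fintype.card_fin]
  by_cases hf : f ∈ characters L
  swap
  · simp [sigmaDelta, sigmaPi, homologySet, hf, dualForm_mem_characters_iff]
  rw [← not_iff_not]
  simp only [sigmaDelta, sigmaPi, homologySet, Set.mem_union, Set.mem_ofPred_eq, hf, hn,
    dualForm_mem_characters_iff, true_and, not_or, not_exists, not_and, not_not]
  constructor
  · intro h
    refine ⟨fun q hq hqn => ?_, ?_⟩
    · refine range_d_adjoint_eq_ker b ρ f (p := n - q) (by omega) ?_ (h _ (by omega))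
      rcases hp : n - q with _ | p
      · exact hasClosedRange_zero ρ f
      · exact hasClosedRange_of_exact b ρ f (by omega) (h p (by omega))
    · rw [← hasClosedRange_iff_adjoint b ρ f (p := k) (by omega)]
      exact hasClosedRange_of_exact b ρ f hk (h k le_rfl)
  · rintro ⟨h, hcl⟩ p hp
    refine range_d_eq_ker_of_adjoint b ρ f (q := n - p) (by omega) ?_ (h _ (by omega) (by omega))
    rw [hasClosedRange_iff_adjoint b ρ f (q := n - p) (by omega)]
    -- For `p < k` closedness follows from exactness of the dual complex in degree `n - p - 1 ≥ n -
    -- k`; for `p = k` it is the extra clause of `σ_π`.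
    rcases hp.eq_or_lt with rfl | hlt
    · exact hcl
    · obtain ⟨q, hq⟩ : ∃ q, n - p = q + 1 := ⟨n - p - 1, by omega⟩
      rw [hq]
      exact hasClosedRange_of_exact (b.map (toOpposite L)) _ _ (by omega)
        (h q (by omega) (by omega))

theorem mem_sigmaPi_iff [CompleteSpace E] (b : Module.Basis (Fin n) ℂ L)
    (ρ : RightAction L E) (f : Module.Dual ℂ L) {k : ℕ} (hk : k ≤ n) :
    f ∈ sigmaPi ρ k ↔ dualForm f ∈ sigmaDelta ρ.adjoint (n - k) := by
  have := b.finiteDimensional_of_finite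
  have := (b.map (toOpposite L)).finiteDimensional_of_finite
  have hn : Module.finrank ℂ L = n := by
    rw [Module.finrank_eq_card_basis b, Fintype.card_fin]
  by_cases hf : f ∈ characters L
  swap
  · simp [sigmaDelta, sigmaPi, homologySet, hf, dualForm_mem_characters_iff]
  rw [← not_iff_not]
  simp only [sigmaDelta, sigmaPi, homologySet, Set.mem_union, Set.mem_ofPred_eq, hf, hn,
    dualForm_mem_characters_iff, true_and, not_or, not_exists, not_and, not_not]
  constructor
  · rintro ⟨h, hcl⟩ q hq
    refine range_d_adjoint_eq_ker b ρ f (p := n - q) (by omega) ?_ (h _ (by omega) (by omega))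
    -- At the edge degree `k` the closed range clause is used; above it, exactness one degree lower.
    rcases (show k ≤ n - q by omega).eq_or_lt with he | hlt
    · rwa [← he]
    · obtain ⟨p, hp⟩ : ∃ p, n - q = p + 1 := ⟨n - q - 1, by omega⟩
      rw [hp]
      exact hasClosedRange_of_exact b ρ f (by omega) (h p (by omega) (by omega))
  · intro h
    refine ⟨fun p hp hpn => ?_, ?_⟩
    · refine range_d_eq_ker_of_adjoint b ρ f (q := n - p) (by omega) ?_ (h _ (by omega))
      rw [hasClosedRange_iff_adjoint b ρ f (q := n - p) (by omega)]
      rcases hq : n - p with _ | q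
      · exact hasClosedRange_zero _ _
      · exact hasClosedRange_of_exact (b.map (toOpposite L)) _ _ (by omega) (h q (by omega))
    · cases k with
      | zero => exact hasClosedRange_zero ρ f
      | succ k =>
        rw [hasClosedRange_iff_adjoint b ρ f (q := n - (k + 1) + 1) (by omega)]
        exact hasClosedRange_of_exact (b.map (toOpposite L)) _ _ (by omega) (h _ le_rfl)

theorem dualForm_surjective : Function.Surjective (dualForm (L := L)) := fun g =>
  ⟨g ∘ₗ (toOpposite L).toLinearMap - traceAd L, by
    ext x
    simp [dualForm]⟩

/-- Since `ad xᵢ` maps `L` into the ideal generated by `xᵢ`, its trace may be computed on `L`. -/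
theorem flagTrace_eq_traceAd (i : Fin n) : flagTrace b i = traceAd L (b i) := by
  have := b.finiteDimensional_of_finite
  have hi : b i ∈ flagIdeal b i := LieSubmodule.subset_lieSpan ⟨i, Set.mem_Iic.mpr le_rfl, rfl⟩
  have h : ∀ x, LieModule.toEnd ℂ L L (b i) x ∈ (flagIdeal b i).toSubmodule := fun x => by
    rw [LieModule.toEnd_apply_apply, ← lie_skew]
    exact neg_mem (lie_mem_right ℂ L (flagIdeal b i) x (b i) hi)
  exact LinearMap.trace_restrict_eq_of_forall_mem _ _ h

theorem dualCoords_dualForm (f : Module.Dual ℂ L) :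
    dualCoords (b.map (toOpposite L)) (dualForm f) = dualCoords b f + flagTrace b := by
  ext i
  rw [Pi.add_apply, flagTrace_eq_traceAd]
  rfl

end Duality

end LieSpectra

end

theorem theorem4p9 {L E : Type*} [LieRing L] [LieAlgebra ℂ L] [FiniteDimensional ℂ L]
    [LieAlgebra.IsSolvable L] [NormedAddCommGroup E] [NormedSpace ℂ E] [CompleteSpace E]
    (ρ : LieSpectra.RightAction L E) {n : ℕ} (b : Module.Basis (Fin n) ℂ L)
    (hb : LieSpectra.IsTriangular b) (k : ℕ) (hk : k ≤ n) :
    (fun c => c + LieSpectra.flagTrace b) ''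
        (LieSpectra.dualCoords b '' LieSpectra.sigmaDelta ρ k) =
      LieSpectra.dualCoords (b.map (LieSpectra.toOpposite L)) ''
        LieSpectra.sigmaPi ρ.adjoint (n - k) ∧
    LieSpectra.dualCoords b '' LieSpectra.sigmaPi ρ k =
      (fun c => c - LieSpectra.flagTrace b) ''
        (LieSpectra.dualCoords (b.map (LieSpectra.toOpposite L)) ''
          LieSpectra.sigmaDelta ρ.adjoint (n - k)) := by
  have h1 : LieSpectra.sigmaPi ρ.adjoint (n - k) =
      LieSpectra.dualForm '' LieSpectra.sigmaDelta ρ k := by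
    -- Surjectivity of `dualForm` turns the pointwise equivalence into an equality of images.
    rw [← Set.image_preimage_eq (LieSpectra.sigmaPi ρ.adjoint (n - k))
      LieSpectra.dualForm_surjective]
    congr 1
    ext f
    exact (LieSpectra.mem_sigmaDelta_iff b ρ f hk).symm
  have h2 : LieSpectra.sigmaDelta ρ.adjoint (n - k) =
      LieSpectra.dualForm '' LieSpectra.sigmaPi ρ k := by
    rw [← Set.image_preimage_eq (LieSpectra.sigmaDelta ρ.adjoint (n - k))
      LieSpectra.dualForm_surjective]
    congr 1
    ext f
    exact (LieSpectra.mem_sigmaPi_iff b ρ f hk).symm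
  rw [h1, h2]
  simp only [Set.image_image, LieSpectra.dualCoords_dualForm, add_sub_cancel_right, and_self]
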